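/- Let $d\in\{2,3\}$ and let $\sigma,\tau,C$ be real constants. All simplices $K$ below are closed, $h_K=\operatorname{diam}K$. **Setting.** Let $\Omega\subset\mathbb R^d$ be a bounded Lipschitz domain, divided by a smooth embedded interface $\Gamma\subset\Omega$ into two nonempty open sets $\Omega_1,\Omega_2$, i.e. $\Omega$ is the disjoint union of $\Omega_1$, $\Gamma$ and $\Omega_2$, and every point of $\overline\Gamma$ has a neighborhood $U$ with a smooth function $\psi:U\to\mathbb R$, $\nabla\psi\neq0$, such that in $U\cap\Omega$ the sets $\Omega_1,\Gamma,\Omega_2$ are $\{\psi>0\},\{\psi=0\},\{\psi<0\}$ ($\Gamma$ may reach $\partial\Omega$). Let $\mathcal T_h$ be a finite conforming triangulation of $\Omega$ into $d$-simplices with $\bigcup_{K\in\mathcal T_h}K=\overline\Omega$ that is shape regular (each $K$ contains a ball of radius $\rho_K>0$ with $h_K\le\sigma\rho_K$) and quasiuniform ($h_K\le h\le\tau h_K$ for all $K$), and let $0\le\delta\le Ch$. For $k=1,2$ let $$\mathcal T_{h,k}=\{K\in\mathcal T_h:\ \exists\,x\in K,\ \operatorname{dist}(x,\Omega_k)\le\delta\},\qquad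 \Omega_{h,k}=\operatorname{int}\bigcup_{K\in\mathcal T_{h,k}}K,$$ let $V_{h,k}$ be the space of continuous functions that are affine on each $K\in\mathcal T_{h,k}$ and vanish on $\partial\Omega\cap\partial\Omega_{h,k}$, with Lagrange nodal basis $\varphi_1,\dots,\varphi_N$ (one function for each vertex of $\mathcal T_{h,k}$ not on $\partial\Omega$), and put $$\mathcal P_k\mathbf v=\sum_{j=1}^N\frac{\int_{\Omega_{h,k}}\mathbf v\,\varphi_j\,dx}{\int_{\Omega_{h,k}}\varphi_j\,dx}\,\varphi_j,\qquad s_{h,k}(u,v)=\int_{\Omega_{h,k}}(\nabla u-\mathcal P_k\nabla u)\cdot\nabla v\,dx .$$ **Claim.** Consider the estimate $$\|\nabla u\|^2_{L^2(\Omega_{h,k})}\le c\,\bigl(\|\nabla u\|^2_{L^2(\Omega_k)}+s_{h,k}(u,u)\bigr)\qquad\text{for all }u\in H^1(\Omega_{h,k}),\ k=1,2. \tag{$*$}$$ 1. There is a constant $c>0$ that depends only on $d,\sigma,\tau,C$ such that for every $\Omega,\Omega_1,\Omega_2,\Gamma$ as above there is $h_0>0$ such that $(*)$ holds with this $c$ for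 all $\mathcal T_h$, $h$, $\delta$ as above with $h\le h_0$. 2. For every $\Omega,\Omega_1,\Omega_2,\Gamma$ as above there is a constant $c'>0$ such that $(*)$ holds with $c'$ in place of $c$ for all $\mathcal T_h$, $h$, $\delta$ as above, without a restriction on $h$. In both cases the constant depends neither on $h$ nor on how $\Gamma$ cuts the simplices of the mesh. -/

import Mathlib

open MeasureTheory Metric
open scoped ContDiff RealInnerProductSpace

noncomputable section

namespace PG

/-- `ℝ^d` with the Euclidean norm. -/
abbrev Eucl (d : ℕ) : Type := EuclideanSpace ℝ (Fin d)

variable {d : ℕ}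

/-! ### Geometry: the domain, the subdomains and the interface -/

/-- A bounded Lipschitz domain: open, connected, bounded and, near each boundary point, in the
direction of a suitable unit vector `e`, the set above the graph of a Lipschitz function `g` of the
component `y - ⟪e, y⟫ e` orthogonal to `e`. -/
structure IsBoundedLipschitzDomain (Ω : Set (Eucl d)) : Prop where
  isOpen : IsOpen Ω
  isConnected : IsConnected Ω
  isBounded : Bornology.IsBounded Ω
  lipschitz_boundary : ∀ x ∈ frontier Ω, ∃ (e : Eucl d) (r : ℝ) (L : NNReal) (g : Eucl d → ℝ),
    ‖e‖ = 1 ∧ 0 < r ∧ LipschitzWith L g ∧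
      ∀ y ∈ ball x r, (y ∈ Ω ↔ g (y - ⟪e, y⟫ • e) < ⟪e, y⟫)

/-- `Ω` is divided by the smooth embedded interface `Γ` into the two nonempty open sets `Ω₁` and
`Ω₂`. Near each point of `Γ`, and up to the boundary of `Ω` if `Γ` reaches it, `Γ` is the zero set
in `Ω` of a smooth function `ψ` with nonvanishing gradient, which is positive in `Ω₁` and negative
in `Ω₂`. -/
structure IsSmoothInterface (Ω Ω₁ Ω₂ Γ : Set (Eucl d)) : Prop where
  isOpen₁ : IsOpen Ω₁
  isOpen₂ : IsOpen Ω₂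
  nonempty₁ : Ω₁.Nonempty
  nonempty₂ : Ω₂.Nonempty
  disjoint : Disjoint Ω₁ Ω₂
  disjoint₁ : Disjoint Ω₁ Γ
  disjoint₂ : Disjoint Ω₂ Γ
  union_eq : Ω₁ ∪ Γ ∪ Ω₂ = Ω
  smooth : ∀ x ∈ closure Γ, ∃ (U : Set (Eucl d)) (ψ : Eucl d → ℝ), IsOpen U ∧ x ∈ U ∧
    ContDiffOn ℝ ∞ ψ U ∧ (∀ y ∈ U, fderiv ℝ ψ y ≠ 0) ∧
    ∀ y ∈ U ∩ Ω, (y ∈ Ω₁ ↔ 0 < ψ y) ∧ (y ∈ Γ ↔ ψ y = 0) ∧ (y ∈ Ω₂ ↔ ψ y < 0)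

/-! ### Triangulations -/

/-- A conforming triangulation of `Ω` fitted to `Ω`: a finite simplicial complex whose
`d`-dimensional simplices cover exactly the closure of `Ω`. -/
structure Triangulation (Ω : Set (Eucl d)) extends Geometry.SimplicialComplex ℝ (Eucl d) where
  finite_faces : faces.Finite
  cover : ⋃ K ∈ {K ∈ faces | K.card = d + 1}, convexHull ℝ (K : Set (Eucl d)) = closure Ω

namespace Triangulation

variable {Ω : Set (Eucl d)} (T : Triangulation Ω)

/-- The vertex sets of the `d`-dimensional simplices; the simplex itself is `convexHull ℝ K`. -/
def cells : Finset (Finset (Eucl d)) :=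
  {K ∈ T.finite_faces.toFinset | K.card = d + 1}

/-- Shape regularity with constant `σ`: each simplex contains a ball of radius `ρ` such that
`diam K ≤ σ ρ`. -/
def IsShapeRegular (σ : ℝ) : Prop :=
  ∀ K ∈ T.cells, ∃ (x : Eucl d) (ρ : ℝ), 0 < ρ ∧
    closedBall x ρ ⊆ convexHull ℝ (K : Set (Eucl d)) ∧
    diam (convexHull ℝ (K : Set (Eucl d))) ≤ σ * ρ

/-- Quasiuniformity of mesh size `h` with constant `τ`: `diam K ≤ h ≤ τ diam K` for each `K`. -/
def IsQuasiUniform (τ h : ℝ) : Prop :=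
  ∀ K ∈ T.cells, diam (convexHull ℝ (K : Set (Eucl d))) ≤ h ∧
    h ≤ τ * diam (convexHull ℝ (K : Set (Eucl d)))

open Classical in
/-- The sub-triangulation of the simplices that meet the closed `δ`-neighbourhood of `Ωk`. -/
def subCells (Ωk : Set (Eucl d)) (δ : ℝ) : Finset (Finset (Eucl d)) :=
  {K ∈ T.cells | ∃ x ∈ convexHull ℝ (K : Set (Eucl d)), infDist x Ωk ≤ δ}

/-- The extended mesh-dependent domain `Ω_{h,k}(δ)`. -/
def extDomain (Ωk : Set (Eucl d)) (δ : ℝ) : Set (Eucl d) :=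
  interior (⋃ K ∈ T.subCells Ωk δ, convexHull ℝ (K : Set (Eucl d)))

/-! ### The lumped projection onto continuous piecewise affine functions -/

/-- `w` is the family of barycentric coordinates of `x` in some simplex that contains `x`, extended
by zero to the points that are not vertices of that simplex. -/
def IsBarycentric (x : Eucl d) (w : Eucl d → ℝ) : Prop :=
  ∃ K ∈ T.cells, (∀ q ∈ K, 0 ≤ w q) ∧ (∀ q ∉ K, w q = 0) ∧
    ∑ q ∈ K, w q = 1 ∧ ∑ q ∈ K, w q • q = x

open Classical in
/-- The Lagrange nodal (hat) function of the vertex `p`: its value at a point `x` of the mesh is the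
barycentric coordinate of `x` at `p`. It is affine on each simplex, one at `p` and zero at the other
vertices; see `hat_eq` and `hat_vertex`. -/
def hat (p x : Eucl d) : ℝ :=
  if h : ∃ w, T.IsBarycentric x w then h.choose p else 0

open Classical in
/-- The nodes of the finite element space `V_{h,k}(δ)` of continuous functions that are affine on
each simplex of the sub-triangulation and vanish on `∂Ω ∩ ∂Ω_{h,k}(δ)`: the vertices of the
sub-triangulation that are not on `∂Ω`. The functions `hat p` of these nodes form the nodal basis
of `V_{h,k}(δ)`. -/
def nodes (Ωk : Set (Eucl d)) (δ : ℝ) : Finset (Eucl d) :=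
  {p ∈ (T.subCells Ωk δ).biUnion id | p ∉ frontier Ω}

/-- The coefficient `∫ φ_p v / ∫ φ_p` of the lumped-mass projection. -/
def coeff (Ωk : Set (Eucl d)) (δ : ℝ) (v : Eucl d → Eucl d) (p : Eucl d) : Eucl d :=
  (∫ x in T.extDomain Ωk δ, T.hat p x)⁻¹ • ∫ x in T.extDomain Ωk δ, T.hat p x • v x

/-- The lumped-mass `L²` projection `𝒫_k v` of a vector field `v` into `(V_{h,k}(δ))^d`. -/
def proj (Ωk : Set (Eucl d)) (δ : ℝ) (v : Eucl d → Eucl d) (x : Eucl d) : Eucl d :=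
  ∑ p ∈ T.nodes Ωk δ, T.hat p x • T.coeff Ωk δ v p

/-- The projected gradient stabilization form `s_{h,k}(u, v) = ∫ (∇u - 𝒫_k ∇u) · ∇v`, in terms of
the gradients of its arguments. -/
def stab (Ωk : Set (Eucl d)) (δ : ℝ) (gradu gradv : Eucl d → Eucl d) : ℝ :=
  ∫ x in T.extDomain Ωk δ, ⟪gradu x - T.proj Ωk δ gradu x, gradv x⟫

end Triangulation

/-! ### Sobolev functions -/

/-- `u ∈ H¹(U)` with weak gradient `gradu`. -/
structure IsH1WithGrad (U : Set (Eucl d)) (u : Eucl d → ℝ) (gradu : Eucl d → Eucl d) : Prop where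
  memLp : MemLp u 2 (volume.restrict U)
  memLp_grad : MemLp gradu 2 (volume.restrict U)
  weak : ∀ φ : Eucl d → ℝ, ContDiff ℝ ∞ φ → HasCompactSupport φ → tsupport φ ⊆ U →
    ∀ v : Eucl d, ∫ x in U, u x * fderiv ℝ φ x v = -∫ x in U, ⟪gradu x, v⟫ * φ x

/-- The estimate `‖∇u‖²_{L²(Ω_{h,k})} ≤ c (‖∇u‖²_{L²(Ω_k)} + s_{h,k}(u, u))` for all
`u ∈ H¹(Ω_{h,k})`. -/
def Triangulation.IsCoercive {Ω : Set (Eucl d)} (T : Triangulation Ω) (Ωk : Set (Eucl d))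
    (δ c : ℝ) : Prop :=
  ∀ (u : Eucl d → ℝ) (gradu : Eucl d → Eucl d), IsH1WithGrad (T.extDomain Ωk δ) u gradu →
    ∫ x in T.extDomain Ωk δ, ‖gradu x‖ ^ 2 ≤
      c * ((∫ x in Ωk, ‖gradu x‖ ^ 2) + T.stab Ωk δ gradu gradu)

/-! ### The hat functions are well defined -/

namespace Triangulation

variable {Ω : Set (Eucl d)} (T : Triangulation Ω)

theorem mem_faces_of_mem_cells {K : Finset (Eucl d)} (hK : K ∈ T.cells) : K ∈ T.faces := by
  have h := (Finset.mem_filter.1 hK).1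
  simpa using h

theorem IsBarycentric.unique {x : Eucl d} {w w' : Eucl d → ℝ}
    (hw : T.IsBarycentric x w) (hw' : T.IsBarycentric x w') : w = w' := by
  classical
  obtain ⟨K, hK, hw0, hwK, hw1, hwx⟩ := hw
  obtain ⟨L, hL, hw0', hwL, hw1', hwx'⟩ := hw'
  have hKf := T.mem_faces_of_mem_cells hK
  have hLf := T.mem_faces_of_mem_cells hL
  have hx : x ∈ convexHull ℝ ((K ∩ L : Finset (Eucl d)) : Set (Eucl d)) := by
    rw [Finset.coe_inter]
    exact T.inter_subset_convexHull hKf hLf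
      ⟨Finset.mem_convexHull'.2 ⟨w, hw0, hw1, hwx⟩, Finset.mem_convexHull'.2 ⟨w', hw0', hw1', hwx'⟩⟩
  obtain ⟨v, -, hv1, hvx⟩ := Finset.mem_convexHull'.1 hx
  have key : ∀ (M : Finset (Eucl d)) (z : Eucl d → ℝ), M ∈ T.faces → K ∩ L ⊆ M →
      (∀ q ∉ M, z q = 0) → ∑ q ∈ M, z q = 1 → ∑ q ∈ M, z q • q = x →
      z = fun q => if q ∈ K ∩ L then v q else 0 := by
    intro M z hM hsub hzM hz1 hzx
    have e1 : ∑ q ∈ M, (if q ∈ K ∩ L then v q else 0) = 1 := by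
      rw [← hv1, ← Finset.sum_filter, Finset.filter_mem_eq_inter, Finset.inter_eq_right.2 hsub]
    have e2 : ∑ q ∈ M, (if q ∈ K ∩ L then v q else 0) • q = x := by
      simp only [ite_smul, zero_smul]
      rw [← hvx, ← Finset.sum_filter, Finset.filter_mem_eq_inter, Finset.inter_eq_right.2 hsub]
    have h := (T.indep hM).eq_zero_of_sum_eq_zero_subtype
      (w := fun q => z q - if q ∈ K ∩ L then v q else 0)
      (by rw [Finset.sum_sub_distrib, hz1, e1, sub_self])
      (by simp only [sub_smul]; rw [Finset.sum_sub_distrib, hzx, e2, sub_self])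
    funext q
    by_cases hq : q ∈ M
    · exact sub_eq_zero.1 (h q hq)
    · rw [hzM q hq, if_neg fun hq' => hq (hsub hq')]
  rw [key K w hKf Finset.inter_subset_left hwK hw1 hwx,
    key L w' hLf Finset.inter_subset_right hwL hw1' hwx']

/-- On each simplex, `hat p` is the barycentric coordinate at `p`. -/
theorem hat_eq {x : Eucl d} {w : Eucl d → ℝ} (hw : T.IsBarycentric x w) (p : Eucl d) :
    T.hat p x = w p := by
  have h : ∃ w, T.IsBarycentric x w := ⟨w, hw⟩
  rw [hat, dif_pos h, IsBarycentric.unique T h.choose_spec hw]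

open Classical in
/-- The hat functions are one at their own vertex and zero at the others. -/
theorem hat_vertex {K : Finset (Eucl d)} (hK : K ∈ T.cells) {q : Eucl d} (hq : q ∈ K)
    (p : Eucl d) : T.hat p q = if p = q then 1 else 0 := by
  refine T.hat_eq (w := fun p => if p = q then 1 else 0) ⟨K, hK, ?_, ?_, ?_, ?_⟩ p
  · intro r _; dsimp only; split_ifs <;> norm_num
  · intro r hr; exact if_neg (fun h : r = q => hr (by rw [h]; exact hq))
  · simp [hq]
  · simp [hq]

end Triangulation

end PG

end

noncomputable section

namespace PG

/-! ### Chains of closed sets, segments, and the geometry of the interface -/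

/-! Write G = ∇u and let g_p be the nodal value of the lumped projection of G at the vertex p, with
g_p = 0 on ∂Ω. The lumped weights give ∫ φ_p g_p·(G − g_p) = 0, and the φ_p of all vertices sum to
one, so s(u,u) = ∫ Σ_p φ_p |G − g_p|² (`stab_eq_integral_energy`). Hence the form splits into
nonnegative contributions of the cells. On each cell it controls the distance of G to the nodal
values, and therefore the differences of nodal values of that cell (`norm_nodeVal_sub_sq_le`).

What is missing is one small nodal value near every cell K (`cell_estimate`). Some x in K has a
nearest point y in the closure of Ωk at distance at most δ ≤ C h. Follow the segment from x to y
until it ends or meets a point that is not interior to the closure of Ω. It meets a bounded number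
of cells, all in the sub-triangulation, and cells that meet share a vertex, so nodal values change
in a controlled way along it. If the last cell has a vertex on ∂Ω, the value there is zero.
Otherwise the segment ends at y, and a ball of radius comparable to h around y lies in the star of
an interior vertex, hence in Ω (`ball_subset_star`). It contains a ball of radius η h inside Ωk, so
some cell of the star has a substantial part in Ωk, on which ‖G‖ bounds a nodal value
(`exists_cell_volume_ge`, `exists_norm_nodeVal_sq_le`). Summing over K with bounded overlap gives
the estimate (`isCoercive`).

The interface enters only through η. At small scales Γ is almost flat and η depends only on d and
the mesh regularity (`exists_ball_subset`). On coarse meshes h is bounded by a multiple of diam Ω +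
1, so a smaller η that depends on the domain still works. -/

/-- If finitely many closed sets cover a preconnected set and each of them meets it, then labels of
the sets that are `D`-close whenever two sets meet are all `card * D`-close. -/
theorem dist_le_card_mul_of_isPreconnected {X ι M : Type*} [TopologicalSpace X]
    [PseudoMetricSpace M] {S : Set X} (hS : IsPreconnected S) (s : Finset ι) (F : ι → Set X)
    (hF : ∀ i ∈ s, IsClosed (F i)) (hcov : S ⊆ ⋃ i ∈ s, F i)
    (hne : ∀ i ∈ s, (S ∩ F i).Nonempty) (f : ι → M) {D : ℝ} (hD0 : 0 ≤ D)
    (hD : ∀ i ∈ s, ∀ j ∈ s, (F i ∩ F j).Nonempty → dist (f i) (f j) ≤ D)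
    {i j : ι} (hi : i ∈ s) (hj : j ∈ s) : dist (f i) (f j) ≤ s.card * D := by
  classical
  -- Join two indices when their sets meet. Connectedness of `S` makes this graph connected, and a
  -- path has fewer edges than there are indices.
  let G : SimpleGraph s := SimpleGraph.fromRel fun i j => (F i ∩ F j).Nonempty
  have hadj : ∀ a b : s, G.Adj a b → dist (f a) (f b) ≤ D := by
    intro a b hab
    obtain ⟨-, h | h⟩ := (SimpleGraph.fromRel_adj _ _ _).1 hab
    · exact hD a a.2 b b.2 h
    · rw [dist_comm]; exact hD b b.2 a a.2 h
  have hwalk : ∀ (a b : s) (w : G.Walk a b), dist (f a) (f b) ≤ w.length * D := by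
    intro a b w
    induction w with
    | nil => simp
    | @cons a c b hac w ih =>
      have h1 := hadj _ _ hac
      have h2 := dist_triangle (f a) (f c) (f b)
      rw [SimpleGraph.Walk.length_cons]
      push_cast
      linarith
  have hreach : ∀ a b : s, G.Reachable a b := by
    intro a b
    by_contra hab
    -- The sets reachable from `a` and the remaining ones have closed unions that cover `S` and both
    -- meet it, so they share a point; that point gives a forbidden edge.
    have hcl : ∀ P : s → Prop, IsClosed (⋃ c ∈ {c : s | P c}, F c) := fun P =>
      (Set.toFinite _).isClosed_biUnion fun c _ => hF c c.2
    obtain ⟨x, -, hx1, hx2⟩ := isPreconnected_closed_iff.1 hS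
      (⋃ c ∈ {c : s | G.Reachable a c}, F c) (⋃ c ∈ {c : s | ¬ G.Reachable a c}, F c)
      (hcl _) (hcl _)
      (by
        intro x hx
        obtain ⟨c, hc, hxc⟩ := Set.mem_iUnion₂.1 (hcov hx)
        by_cases h : G.Reachable a ⟨c, hc⟩
        · exact Or.inl (Set.mem_iUnion₂.2 ⟨⟨c, hc⟩, h, hxc⟩)
        · exact Or.inr (Set.mem_iUnion₂.2 ⟨⟨c, hc⟩, h, hxc⟩))
      (by
        obtain ⟨x, hx, hxa⟩ := hne a a.2
        exact ⟨x, hx, Set.mem_iUnion₂.2 ⟨a, SimpleGraph.Reachable.refl a, hxa⟩⟩)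
      (by
        obtain ⟨x, hx, hxb⟩ := hne b b.2
        exact ⟨x, hx, Set.mem_iUnion₂.2 ⟨b, hab, hxb⟩⟩)
    obtain ⟨c, hc, hxc⟩ := Set.mem_iUnion₂.1 hx1
    obtain ⟨e, he, hxe⟩ := Set.mem_iUnion₂.1 hx2
    refine he (SimpleGraph.Reachable.trans hc ?_)
    by_cases hce : c = e
    · rw [hce]
    · exact SimpleGraph.Adj.reachable
        ((SimpleGraph.fromRel_adj _ _ _).2 ⟨hce, Or.inl ⟨x, hxc, hxe⟩⟩)
  obtain ⟨w, hw⟩ := (hreach ⟨i, hi⟩ ⟨j, hj⟩).exists_isPath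
  have h1 := hwalk _ _ w
  have h2 : (w.length : ℝ) ≤ s.card := by
    have := hw.length_lt
    rw [Fintype.card_coe] at this
    exact_mod_cast this.le
  exact h1.trans (mul_le_mul_of_nonneg_right h2 hD0)

/-- Starting from a point of a closed set `A` one can follow a segment inside `A` up to its end or
up to a point that is not interior to `A`. -/
theorem exists_segment_subset_or_notMem_interior {E : Type*} [NormedAddCommGroup E]
    [NormedSpace ℝ E] {A : Set E} (hA : IsClosed A) {x : E} (hx : x ∈ A) (y : E) :
    ∃ z ∈ segment ℝ x y, segment ℝ x z ⊆ A ∧ (z = y ∨ z ∉ interior A) := by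
  set γ : ℝ → E := fun t => AffineMap.lineMap x y t with hγ
  have hγc : Continuous γ := AffineMap.lineMap_continuous
  -- The parameters at which the walk has to stop; 1 is among them, so by compactness there is a
  -- first one.
  let B : Set ℝ := Set.Icc 0 1 ∩ ({1} ∪ γ ⁻¹' (interior A)ᶜ)
  have hB : IsCompact B := isCompact_Icc.inter_right
    (isClosed_singleton.union (isOpen_interior.isClosed_compl.preimage hγc))
  obtain ⟨t, ht, hmin⟩ := hB.exists_isLeast ⟨1, by simp [B]⟩
  have hlt : ∀ s ∈ Set.Ico 0 t, γ s ∈ A := by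
    intro s hs
    by_contra h
    have : s ∈ B := ⟨⟨hs.1, hs.2.le.trans ht.1.2⟩, Or.inr fun h' => h (interior_subset h')⟩
    exact absurd (hmin this) (not_le.2 hs.2)
  have hle : ∀ s ∈ Set.Icc 0 t, γ s ∈ A := by
    intro s hs
    rcases eq_or_ne t 0 with h0 | h0
    · have : s = 0 := le_antisymm (h0 ▸ hs.2) hs.1
      simpa [this, hγ] using hx
    · rw [← closure_Ico h0.symm] at hs
      have := image_closure_subset_closure_image hγc ⟨s, hs, rfl⟩
      exact closure_minimal (by rintro _ ⟨r, hr, rfl⟩; exact hlt r hr) hA this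
  refine ⟨γ t, ?_, ?_, ?_⟩
  · rw [segment_eq_image_lineMap]; exact ⟨t, ht.1, rfl⟩
  · rw [segment_eq_image_lineMap]
    rintro _ ⟨s, hs, rfl⟩
    have : AffineMap.lineMap x (γ t) s = γ (s * t) := by
      simp only [hγ, AffineMap.lineMap_apply_module]
      module
    rw [this]
    exact hle _ ⟨mul_nonneg hs.1 ht.1.1, mul_le_of_le_one_left ht.1.1 hs.2⟩
  · rcases ht.2 with h | h
    · left
      simp [Set.mem_singleton_iff.1 h, hγ]
    · exact Or.inr h

variable {d : ℕ}

/-- A Lipschitz domain has no slits: below the graph, arbitrarily close to any boundary point, lie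
open sets that miss Ω and hence its closure. Moving a boundary point by `-t • e` reaches them. -/
theorem IsBoundedLipschitzDomain.interior_closure_subset {Ω : Set (Eucl d)}
    (hΩ : IsBoundedLipschitzDomain Ω) : interior (closure Ω) ⊆ Ω := by
  intro x hx
  by_contra hxΩ
  have hfr : x ∈ frontier Ω := ⟨interior_subset hx, by rwa [hΩ.isOpen.interior_eq]⟩
  obtain ⟨e, r, L, g, he, hr, hg, hmem⟩ := hΩ.lipschitz_boundary x hfr
  let A : Set (Eucl d) := {y | ⟪e, y⟫ < g (y - ⟪e, y⟫ • e)}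
  have hA : IsOpen A := isOpen_lt (by fun_prop) (hg.continuous.comp (by fun_prop))
  have hdisj : Disjoint (closure Ω) (A ∩ ball x r) := by
    refine Disjoint.closure_left ?_ (hA.inter isOpen_ball)
    rw [Set.disjoint_left]
    rintro y hy ⟨hyA, hyb⟩
    exact lt_asymm hyA ((hmem y hyb).1 hy)
  have hxle : ⟪e, x⟫ ≤ g (x - ⟪e, x⟫ • e) := by
    have := mt (hmem x (mem_ball_self hr)).2 hxΩ
    exact not_lt.1 this
  have hcont : Filter.Tendsto (fun t : ℝ => x - t • e) (nhdsWithin 0 (Set.Ioi 0)) (nhds x) := by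
    have : Continuous fun t : ℝ => x - t • e := by fun_prop
    simpa using (this.tendsto 0).mono_left nhdsWithin_le_nhds
  have hev := ((hcont.eventually (mem_interior_iff_mem_nhds.1 hx)).and
    (hcont.eventually (ball_mem_nhds x hr))).and
    (self_mem_nhdsWithin : Set.Ioi (0 : ℝ) ∈ nhdsWithin 0 (Set.Ioi 0))
  obtain ⟨t, ⟨h1, h2⟩, ht⟩ := hev.exists
  refine Set.disjoint_left.1 hdisj h1 ⟨?_, h2⟩
  have hee : ⟪e, e⟫ = 1 := by rw [real_inner_self_eq_norm_sq, he]; norm_num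
  have h3 : ⟪e, x - t • e⟫ = ⟪e, x⟫ - t := by
    rw [inner_sub_right, real_inner_smul_right, hee, mul_one]
  have h4 : x - t • e - (⟪e, x⟫ - t) • e = x - ⟪e, x⟫ • e := by module
  change ⟪e, x - t • e⟫ < g (x - t • e - ⟪e, x - t • e⟫ • e)
  rw [h3, h4]
  have : (0 : ℝ) < t := ht
  linarith

/-- Replacing ψ by −ψ exchanges the roles of the subdomains, so only the first one needs to be
treated. -/
theorem IsSmoothInterface.symm {Ω Ω₁ Ω₂ Γ : Set (Eucl d)} (hI : IsSmoothInterface Ω Ω₁ Ω₂ Γ) :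
    IsSmoothInterface Ω Ω₂ Ω₁ Γ where
  isOpen₁ := hI.isOpen₂
  isOpen₂ := hI.isOpen₁
  nonempty₁ := hI.nonempty₂
  nonempty₂ := hI.nonempty₁
  disjoint := hI.disjoint.symm
  disjoint₁ := hI.disjoint₂
  disjoint₂ := hI.disjoint₁
  union_eq := by
    rw [← hI.union_eq]
    ext x; simp only [Set.mem_union]; tauto
  smooth := by
    intro x hx
    obtain ⟨U, ψ, hU, hxU, hψ, hd, h⟩ := hI.smooth x hx
    refine ⟨U, fun y => -ψ y, hU, hxU, hψ.neg, fun y hy => ?_, fun y hy => ?_⟩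
    · have : fderiv ℝ (fun y => -ψ y) y = - fderiv ℝ ψ y := fderiv_fun_neg
      rw [this]; exact neg_ne_zero.2 (hd y hy)
    · obtain ⟨h1, h2, h3⟩ := h y hy
      simp only [h1, h2, h3, neg_eq_zero, Left.neg_pos_iff, Left.neg_neg_iff, and_self]

/-- Near a point of the closure of Γ the level function is almost linear, uniformly in the base
point. Starting where ψ ≥ 0 and going a distance r/2 along its gradient therefore reaches a ball on
which ψ > 0. -/
theorem IsSmoothInterface.exists_ball_local {Ω Ω₁ Ω₂ Γ : Set (Eucl d)}
    (hI : IsSmoothInterface Ω Ω₁ Ω₂ Γ) {x : Eucl d} (hx : x ∈ closure Γ) :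
    ∃ ε : ℝ, 0 < ε ∧ ∀ (y : Eucl d) (r : ℝ), 0 < r → ball y r ⊆ ball x ε → y ∈ closure Ω₁ →
      ball y r ⊆ Ω → ∃ z, ball z (r / 4) ⊆ Ω₁ ∩ ball y r := by
  obtain ⟨U, ψ, hU, hxU, hψ, hdψ, hsign⟩ := hI.smooth x hx
  have hstrict : HasStrictFDerivAt ψ (fderiv ℝ ψ x) x :=
    (hψ.contDiffAt (hU.mem_nhds hxU)).hasStrictFDerivAt (by simp)
  set n := (InnerProductSpace.toDual ℝ (Eucl d)).symm (fderiv ℝ ψ x) with hn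
  have hn0 : 0 < ‖n‖ := by
    rw [norm_pos_iff, hn]
    simpa using hdψ x hxU
  have hL : ∀ v, fderiv ℝ ψ x v = ⟪n, v⟫ := fun v => by
    rw [hn, InnerProductSpace.toDual_symm_apply]
  have hev : ∀ᶠ q : Eucl d × Eucl d in nhds (x, x),
      ‖ψ q.1 - ψ q.2 - fderiv ℝ ψ x (q.1 - q.2)‖ ≤ ‖n‖ / 4 * ‖q.1 - q.2‖ :=
    hstrict.isLittleO.def (by positivity)
  rw [nhds_prod_eq] at hev
  obtain ⟨A, hA, hA'⟩ := Filter.mem_prod_self_iff.1 hev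
  obtain ⟨ε, hε, hεA⟩ := Metric.mem_nhds_iff.1 (Filter.inter_mem hA (hU.mem_nhds hxU))
  refine ⟨ε, hε, fun y r hr hyr hy hyΩ => ?_⟩
  have hyb := mem_ball_self (x := y) hr
  have hyψ : 0 ≤ ψ y := by
    by_contra h
    have : y ∈ Ω₂ := (hsign y ⟨(hεA (hyr hyb)).2, hyΩ hyb⟩).2.2.2 (not_le.1 h)
    exact Set.disjoint_left.1 (hI.disjoint.closure_left hI.isOpen₂) hy this
  -- The shift gains ‖n‖ r/2. The offset `e` loses less than ‖n‖ r/4 and the linearization error is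
  -- below 3‖n‖ r/16, so ψ stays positive.
  refine ⟨y + (r / 2 / ‖n‖) • n, fun w hw => ?_⟩
  obtain ⟨e, rfl⟩ : ∃ e, w = y + (r / 2 / ‖n‖) • n + e := ⟨w - (y + (r / 2 / ‖n‖) • n), by abel⟩
  have he : ‖e‖ < r / 4 := by simpa [dist_eq_norm] using hw
  set u := (r / 2 / ‖n‖) • n + e with hu
  have hwu : y + (r / 2 / ‖n‖) • n + e = y + u := by rw [hu, add_assoc]
  have h1 : ‖(r / 2 / ‖n‖) • n‖ = r / 2 := by
    rw [norm_smul, Real.norm_of_nonneg (by positivity)]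
    field_simp
  have hun : ‖u‖ < 3 / 4 * r := by
    have := norm_add_le ((r / 2 / ‖n‖) • n) e
    rw [h1] at this
    linarith
  have hwr : y + u ∈ ball y r := by
    rw [mem_ball, dist_eq_norm, add_sub_cancel_left]; linarith
  rw [hwu]
  refine ⟨(hsign _ ⟨(hεA (hyr hwr)).2, hyΩ hwr⟩).1.2 ?_, hwr⟩
  have h2 := hA' (Set.mk_mem_prod (hεA (hyr hwr)).1 (hεA (hyr hyb)).1)
  simp only [Set.mem_ofPred_eq, add_sub_cancel_left, hL] at h2
  have h3 : ⟪n, u⟫ = ‖n‖ * (r / 2) + ⟪n, e⟫ := by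
    rw [hu, inner_add_right, real_inner_smul_right, real_inner_self_eq_norm_sq]
    field_simp
  have h4 := abs_le.1 (abs_real_inner_le_norm n e)
  have h5 := abs_le.1 (Real.norm_eq_abs _ ▸ h2)
  have h6 := mul_lt_mul_of_pos_left he hn0
  have h7 := mul_lt_mul_of_pos_left hun hn0
  nlinarith [h4.1, h5.1, mul_pos hn0 hr]

/-- At small scales, a ball in `Ω` around a point of `closure Ω₁` contains a ball of comparable
radius that lies in `Ω₁`. -/
theorem IsSmoothInterface.exists_ball_subset {Ω Ω₁ Ω₂ Γ : Set (Eucl d)}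
    (hΩ : Bornology.IsBounded Ω) (hI : IsSmoothInterface Ω Ω₁ Ω₂ Γ) :
    ∃ r₀ : ℝ, 0 < r₀ ∧ ∀ r, 0 < r → r ≤ r₀ → ∀ y ∈ closure Ω₁, ball y r ⊆ Ω →
      ∃ z, ball z (r / 4) ⊆ Ω₁ ∩ ball y r := by
  have hΓ : Γ ⊆ Ω := by
    rw [← hI.union_eq]; exact fun x hx => Or.inl (Or.inr hx)
  have hcomp : IsCompact (closure Γ) := (hΩ.subset hΓ).isCompact_closure
  choose ε hε hloc using fun x : closure Γ => hI.exists_ball_local x.2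
  obtain ⟨δ, hδ, hleb⟩ := lebesgue_number_lemma_of_metric hcomp
    (c := fun x : closure Γ => ball (x : Eucl d) (ε x)) (fun _ => isOpen_ball)
    (fun x hx => Set.mem_iUnion.2 ⟨⟨x, hx⟩, mem_ball_self (hε _)⟩)
  -- With r ≤ δ/2, a ball of radius r that meets Γ at `q` lies in the ball of radius δ around `q`,
  -- hence in one of the local neighbourhoods. A ball in Ω that misses Γ is connected and stays in
  -- Ω₁.
  refine ⟨δ / 2, by positivity, fun r hr hrδ y hy hyΩ => ?_⟩
  by_cases hmeet : ∃ q ∈ Γ, q ∈ ball y r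
  · obtain ⟨q, hq, hqy⟩ := hmeet
    obtain ⟨x, hx⟩ := hleb q (subset_closure hq)
    refine hloc x y r hr (Set.Subset.trans (fun w hw => ?_) hx) hy hyΩ
    rw [mem_ball] at *
    have := dist_triangle w y q
    rw [dist_comm y q] at this
    linarith
  · refine ⟨y, fun w hw => ?_⟩
    have hw' : w ∈ ball y r := ball_subset_ball (by linarith) hw
    refine ⟨?_, hw'⟩
    have hsub : ball y r ⊆ Ω₁ ∪ Ω₂ := by
      intro v hv
      have := hyΩ hv
      rw [← hI.union_eq] at this
      rcases this with (h | h) | h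
      · exact Or.inl h
      · exact absurd ⟨v, h, hv⟩ hmeet
      · exact Or.inr h
    have hne : (ball y r ∩ Ω₁).Nonempty := mem_closure_iff.1 hy _ isOpen_ball (mem_ball_self hr)
    exact (convex_ball y r).isPreconnected.subset_left_of_subset_union hI.isOpen₁ hI.isOpen₂
      hI.disjoint hsub hne hw'

/-! ### Barycentric coordinates of a simplex -/

open Classical in
/-- The barycentric coordinate at `p` of a simplex with vertex set `K`, as an affine function on
the whole space; zero if `p` is not a vertex or `K` is not an affine basis. -/
def bary (K : Finset (Eucl d)) (p : Eucl d) : Eucl d →ᵃ[ℝ] ℝ :=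
  if h : AffineIndependent ℝ ((↑) : K → Eucl d) ∧
      affineSpan ℝ (Set.range ((↑) : K → Eucl d)) = ⊤ ∧ p ∈ K then
    (AffineBasis.mk _ h.1 h.2.1).coord ⟨p, h.2.2⟩
  else 0

theorem bary_of_notMem {K : Finset (Eucl d)} {p : Eucl d} (hp : p ∉ K) (x : Eucl d) :
    bary K p x = 0 := by
  rw [bary, dif_neg fun h => hp h.2.2]; rfl

theorem continuous_bary (K : Finset (Eucl d)) (p : Eucl d) : Continuous (bary K p) :=
  AffineMap.continuous_of_finiteDimensional _

theorem bary_lineMap (K : Finset (Eucl d)) (p x y : Eucl d) (t : ℝ) :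
    bary K p (AffineMap.lineMap x y t) = (1 - t) * bary K p x + t * bary K p y := by
  rw [AffineMap.apply_lineMap, AffineMap.lineMap_apply_module, smul_eq_mul, smul_eq_mul]

namespace Triangulation

variable {Ω : Set (Eucl d)} (T : Triangulation Ω)

theorem card_of_mem_cells {K : Finset (Eucl d)} (hK : K ∈ T.cells) : K.card = d + 1 :=
  (Finset.mem_filter.1 hK).2

theorem mem_closure_iff {x : Eucl d} :
    x ∈ closure Ω ↔ ∃ K ∈ T.cells, x ∈ convexHull ℝ (K : Set (Eucl d)) := by
  rw [← T.cover]
  simp [cells]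

variable {T}

theorem convexHull_subset_closure {K : Finset (Eucl d)} (hK : K ∈ T.cells) :
    convexHull ℝ (K : Set (Eucl d)) ⊆ closure Ω := fun _ hx => T.mem_closure_iff.2 ⟨K, hK, hx⟩

theorem affineSpan_eq_top {K : Finset (Eucl d)} (hK : K ∈ T.cells) :
    affineSpan ℝ (Set.range ((↑) : K → Eucl d)) = ⊤ := by
  rw [(T.indep (T.mem_faces_of_mem_cells hK)).affineSpan_eq_top_iff_card_eq_finrank_add_one]
  simp [T.card_of_mem_cells hK]

variable (T) in
/-- The vertices of a cell as an affine basis. -/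
def affineBasis {K : Finset (Eucl d)} (hK : K ∈ T.cells) : AffineBasis K ℝ (Eucl d) :=
  ⟨(↑), T.indep (T.mem_faces_of_mem_cells hK), affineSpan_eq_top hK⟩

theorem bary_eq_coord {K : Finset (Eucl d)} (hK : K ∈ T.cells) (p : K) :
    bary K p = (T.affineBasis hK).coord p := by
  rw [bary, dif_pos ⟨T.indep (T.mem_faces_of_mem_cells hK), affineSpan_eq_top hK, p.2⟩]
  rfl

theorem sum_bary {K : Finset (Eucl d)} (hK : K ∈ T.cells) (x : Eucl d) :
    ∑ p ∈ K, bary K p x = 1 := by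
  rw [← Finset.sum_coe_sort, ← (T.affineBasis hK).sum_coord_apply_eq_one x]
  simp_rw [bary_eq_coord hK]

theorem sum_bary_smul {K : Finset (Eucl d)} (hK : K ∈ T.cells) (x : Eucl d) :
    ∑ p ∈ K, bary K p x • p = x := by
  conv_rhs => rw [← (T.affineBasis hK).linear_combination_coord_eq_self x]
  rw [← Finset.sum_coe_sort]
  simp_rw [bary_eq_coord hK]
  rfl

theorem mem_convexHull_iff {K : Finset (Eucl d)} (hK : K ∈ T.cells) {x : Eucl d} :
    x ∈ convexHull ℝ (K : Set (Eucl d)) ↔ ∀ p ∈ K, 0 ≤ bary K p x := by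
  have h := (T.affineBasis hK).convexHull_eq_nonneg_coord
  have h' : Set.range (T.affineBasis hK) = (K : Set (Eucl d)) := Subtype.range_coe
  rw [h'] at h
  rw [h]
  simp only [Set.mem_ofPred_eq, ← bary_eq_coord hK, Subtype.forall]

theorem mem_interior_convexHull_iff {K : Finset (Eucl d)} (hK : K ∈ T.cells) {x : Eucl d} :
    x ∈ interior (convexHull ℝ (K : Set (Eucl d))) ↔ ∀ p ∈ K, 0 < bary K p x := by
  have h := (T.affineBasis hK).interior_convexHull
  have h' : Set.range (T.affineBasis hK) = (K : Set (Eucl d)) := Subtype.range_coe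
  rw [h'] at h
  rw [h]
  simp only [Set.mem_ofPred_eq, ← bary_eq_coord hK, Subtype.forall]

theorem bary_self {K : Finset (Eucl d)} (hK : K ∈ T.cells) {p : Eucl d} (hp : p ∈ K) :
    bary K p p = 1 := by
  have := (T.affineBasis hK).coord_apply_eq ⟨p, hp⟩
  rw [← bary_eq_coord hK] at this
  exact this

theorem bary_ne {K : Finset (Eucl d)} (hK : K ∈ T.cells) {p q : Eucl d} (hq : q ∈ K)
    (hpq : p ≠ q) : bary K p q = 0 := by
  by_cases hp : p ∈ K
  · have := (T.affineBasis hK).coord_apply_ne (i := ⟨p, hp⟩) (j := ⟨q, hq⟩)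
      (fun h => hpq (congrArg Subtype.val h))
    rw [← bary_eq_coord hK] at this
    exact this
  · exact bary_of_notMem hp q

theorem bary_nonneg {K : Finset (Eucl d)} (hK : K ∈ T.cells) {x : Eucl d}
    (hx : x ∈ convexHull ℝ (K : Set (Eucl d))) (p : Eucl d) : 0 ≤ bary K p x := by
  by_cases hp : p ∈ K
  · exact (mem_convexHull_iff hK).1 hx p hp
  · exact (bary_of_notMem hp x).ge

theorem bary_le_one {K : Finset (Eucl d)} (hK : K ∈ T.cells) {x : Eucl d}
    (hx : x ∈ convexHull ℝ (K : Set (Eucl d))) (p : Eucl d) : bary K p x ≤ 1 := by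
  by_cases hp : p ∈ K
  · rw [← sum_bary hK x]
    exact Finset.single_le_sum (f := fun q => bary K q x) (fun q _ => bary_nonneg hK hx q) hp
  · rw [bary_of_notMem hp]; exact zero_le_one

theorem hat_eq_bary {K : Finset (Eucl d)} (hK : K ∈ T.cells) {x : Eucl d}
    (hx : x ∈ convexHull ℝ (K : Set (Eucl d))) (p : Eucl d) : T.hat p x = bary K p x :=
  T.hat_eq (w := fun p => bary K p x)
    ⟨K, hK, (mem_convexHull_iff hK).1 hx, fun _ hq => bary_of_notMem hq x, sum_bary hK x,
      sum_bary_smul hK x⟩ p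

theorem isClosed_cell (K : Finset (Eucl d)) : IsClosed (convexHull ℝ (K : Set (Eucl d))) :=
  (K.finite_toSet.isCompact_convexHull (𝕜 := ℝ)).isClosed

theorem isBounded_cell (K : Finset (Eucl d)) :
    Bornology.IsBounded (convexHull ℝ (K : Set (Eucl d))) :=
  (K.finite_toSet.isCompact_convexHull (𝕜 := ℝ)).isBounded

theorem exists_mem_inter {K L : Finset (Eucl d)} (hK : K ∈ T.cells) (hL : L ∈ T.cells)
    (h : (convexHull ℝ (K : Set (Eucl d)) ∩ convexHull ℝ (L : Set (Eucl d))).Nonempty) :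
    ∃ p ∈ K, p ∈ L := by
  obtain ⟨x, hx⟩ := h
  have := T.inter_subset_convexHull (T.mem_faces_of_mem_cells hK) (T.mem_faces_of_mem_cells hL) hx
  obtain ⟨p, hp⟩ := convexHull_nonempty_iff.1 ⟨x, this⟩
  exact ⟨p, hp.1, hp.2⟩

/-- The hat function of a vertex of one cell that is not a vertex of the other would be positive and
zero at a common interior point. -/
theorem disjoint_interior {K L : Finset (Eucl d)} (hK : K ∈ T.cells) (hL : L ∈ T.cells)
    (hKL : K ≠ L) : Disjoint (interior (convexHull ℝ (K : Set (Eucl d))))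
      (interior (convexHull ℝ (L : Set (Eucl d)))) := by
  rw [Set.disjoint_left]
  intro x hxK hxL
  obtain ⟨p, hp, hpL⟩ : ∃ p ∈ K, p ∉ L := by
    by_contra! h
    exact hKL (Finset.eq_of_subset_of_card_le h
      (by rw [T.card_of_mem_cells hK, T.card_of_mem_cells hL]))
  have h1 := (mem_interior_convexHull_iff hK).1 hxK p hp
  rw [← hat_eq_bary hK (interior_subset hxK), hat_eq_bary hL (interior_subset hxL),
    bary_of_notMem hpL] at h1
  exact lt_irrefl _ h1

/-! ### Stars of interior vertices -/

variable (T) in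
/-- The union of the cells with vertex `p`. -/
def star (p : Eucl d) : Set (Eucl d) :=
  ⋃ K ∈ {K ∈ T.cells | p ∈ K}, convexHull ℝ (K : Set (Eucl d))

theorem mem_star_iff {p x : Eucl d} :
    x ∈ T.star p ↔ ∃ K ∈ T.cells, p ∈ K ∧ x ∈ convexHull ℝ (K : Set (Eucl d)) := by
  simp [star, and_assoc]

/-- The cells that miss `x` are finitely many closed sets, so a neighbourhood of `x` misses them
too. -/
theorem eventually_mem_cell_imp (x : Eucl d) : ∀ᶠ z in nhds x, ∀ L ∈ T.cells,
    z ∈ convexHull ℝ (L : Set (Eucl d)) → x ∈ convexHull ℝ (L : Set (Eucl d)) := by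
  rw [Filter.eventually_all_finset]
  intro L _
  by_cases h : x ∈ convexHull ℝ (L : Set (Eucl d))
  · exact Filter.Eventually.of_forall fun _ _ => h
  · filter_upwards [(isClosed_cell L).isOpen_compl.mem_nhds h] with z hz hz'
    exact absurd hz' hz

/-- The homothety with centre `p` and small ratio t moves a point z near `x` close to `p`, where Ω
is covered. A cell that contains the image has `p` as a vertex, and scaling back keeps its other
barycentric coordinates nonnegative. The coordinate at `p` is positive by continuity, so the cell
contains z. -/
theorem star_mem_nhds {p x : Eucl d} (hp : p ∈ interior (closure Ω)) {K : Finset (Eucl d)}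
    (hK : K ∈ T.cells) (hx : x ∈ convexHull ℝ (K : Set (Eucl d))) (hpx : 0 < bary K p x) :
    T.star p ∈ nhds x := by
  have hpK : p ∈ K := by
    by_contra h
    rw [bary_of_notMem h] at hpx
    exact lt_irrefl _ hpx
  have htend : Filter.Tendsto (fun t : ℝ => AffineMap.lineMap p x t)
      (nhdsWithin 0 (Set.Ioi 0)) (nhds p) := by
    have h : Continuous fun t : ℝ => AffineMap.lineMap p x t := AffineMap.lineMap_continuous
    simpa using (h.tendsto 0).mono_left nhdsWithin_le_nhds
  have hev := (htend.eventually (isOpen_interior.mem_nhds hp)).and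
    (Ioc_mem_nhdsGT (zero_lt_one' ℝ))
  obtain ⟨t, hxt, ht0, ht1⟩ := hev.exists
  have hc : Continuous fun z : Eucl d => AffineMap.lineMap p z t := by
    simp only [AffineMap.lineMap_apply_module]
    fun_prop
  have e1 := hc.continuousAt.eventually (isOpen_interior.mem_nhds hxt)
  have e2 := hc.continuousAt.eventually (T.eventually_mem_cell_imp (AffineMap.lineMap p x t))
  have e3 : ∀ᶠ z in nhds x, ∀ L ∈ T.cells, 0 < bary L p x → 0 < bary L p z := by
    rw [Filter.eventually_all_finset]
    intro L _
    by_cases h : 0 < bary L p x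
    · filter_upwards [(continuous_bary L p).continuousAt.eventually (lt_mem_nhds h)] with z hz _
      exact hz
    · exact Filter.Eventually.of_forall fun _ h' => absurd h' h
  have hxtK : AffineMap.lineMap p x t ∈ convexHull ℝ (K : Set (Eucl d)) :=
    (convex_convexHull ℝ _).lineMap_mem (subset_convexHull ℝ _ hpK) hx ⟨ht0.le, ht1⟩
  have hKt := bary_lineMap K p p x t
  rw [bary_self hK hpK] at hKt
  filter_upwards [e1, e2, e3] with z h1 h2 h3
  obtain ⟨L, hL, hzL⟩ := T.mem_closure_iff.1 (interior_subset h1)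
  have hxL := h2 L hL hzL
  -- Both sides are the value of the hat function of `p` at the same point. The left one is
  -- positive, which forces `p ∈ L`.
  have hKL : bary K p (AffineMap.lineMap p x t) = bary L p (AffineMap.lineMap p x t) := by
    rw [← hat_eq_bary hK hxtK, ← hat_eq_bary hL hxL]
  have hpL : p ∈ L := by
    by_contra h
    rw [bary_of_notMem h] at hKL
    nlinarith [mul_pos ht0 hpx]
  have hLt := bary_lineMap L p p x t
  rw [bary_self hL hpL] at hLt
  have hLx : bary L p x = bary K p x := by
    have : t * bary L p x = t * bary K p x := by linarith
    exact mul_left_cancel₀ ht0.ne' this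
  refine mem_star_iff.2 ⟨L, hL, hpL, (mem_convexHull_iff hL).2 fun q hq => ?_⟩
  by_cases hqp : q = p
  · rw [hqp]; exact (h3 L hL (hLx ▸ hpx)).le
  · have h4 := bary_lineMap L q p z t
    rw [bary_ne hL hpL hqp, mul_zero, zero_add] at h4
    have h5 := bary_nonneg hL hzL q
    rw [h4] at h5
    exact nonneg_of_mul_nonneg_right h5 ht0

/-- A cell that contains a point of `∂Ω` has a vertex on `∂Ω`. -/
theorem exists_vertex_notMem_interior {K : Finset (Eucl d)} (hK : K ∈ T.cells) {x : Eucl d}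
    (hx : x ∈ convexHull ℝ (K : Set (Eucl d))) (hxi : x ∉ interior (closure Ω)) :
    ∃ p ∈ K, p ∉ interior (closure Ω) := by
  obtain ⟨p, hp, hpos⟩ : ∃ p ∈ K, 0 < bary K p x := by
    by_contra! h
    have := Finset.sum_nonpos h
    rw [sum_bary hK] at this
    linarith
  refine ⟨p, hp, fun hpi => hxi ?_⟩
  rw [mem_interior_iff_mem_nhds]
  refine Filter.mem_of_superset (star_mem_nhds hpi hK hx hpos) fun z hz => ?_
  obtain ⟨L, hL, -, hzL⟩ := mem_star_iff.1 hz
  exact convexHull_subset_closure hL hzL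

/-- On the way from `y` to a point of the ball the hat function of `p` decreases at rate at most
`M`, so it stays positive and the star cannot be left. This is a continuation argument along the
segment, with `star_mem_nhds` as its local step. -/
theorem ball_subset_star {p y : Eucl d} (hp : p ∈ interior (closure Ω)) {K : Finset (Eucl d)}
    (hK : K ∈ T.cells) (hy : y ∈ convexHull ℝ (K : Set (Eucl d))) {M r : ℝ} (hM0 : 0 < M)
    (hM : ∀ L ∈ T.cells, ∀ u v, |bary L p u - bary L p v| ≤ M * dist u v)
    (hr : M * r ≤ bary K p y) : ball y r ⊆ T.star p := by
  intro z hz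
  rw [mem_ball, dist_comm] at hz
  have hpos : 0 < bary K p y :=
    (mul_pos hM0 (dist_nonneg.trans_lt hz)).trans_le hr
  have hstar : ∀ L ∈ T.cells, ∀ w, 0 < bary L p w → p ∈ L := by
    intro L _ w hw
    by_contra h
    rw [bary_of_notMem h] at hw
    exact lt_irrefl _ hw
  set γ : ℝ → Eucl d := fun t => AffineMap.lineMap y z t with hγ
  have hγc : Continuous γ := AffineMap.lineMap_continuous
  let S : Set ℝ := ⋃ L ∈ T.cells, {t | γ t ∈ convexHull ℝ (L : Set (Eucl d)) ∧
    bary K p y - M * (t * dist y z) ≤ bary L p (γ t)}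
  have hS : IsClosed S := by
    refine T.cells.finite_toSet.isClosed_biUnion fun L _ => ?_
    exact ((isClosed_cell L).preimage hγc).inter
      (isClosed_le (by fun_prop) ((continuous_bary L p).comp hγc))
  have h0 : (0 : ℝ) ∈ S := Set.mem_iUnion₂.2 ⟨K, hK, by simpa [hγ] using hy, by simp [hγ]⟩
  have hpos' : ∀ t ≤ (1 : ℝ), 0 < bary K p y - M * (t * dist y z) := by
    intro t ht
    have : M * (t * dist y z) < M * r := by
      refine mul_lt_mul_of_pos_left ?_ hM0
      refine lt_of_le_of_lt ?_ hz
      exact mul_le_of_le_one_left dist_nonneg ht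
    linarith
  have hsub : Set.Icc (0 : ℝ) 1 ⊆ S := by
    -- It suffices that the closed set `S` can be continued to the right of each of its points
    -- before 1.
    refine (hS.inter isClosed_Icc).Icc_subset_of_forall_mem_nhdsWithin h0 ?_
    rintro t ⟨htS, ht0, ht1⟩
    obtain ⟨L, hL, htL, hle⟩ := Set.mem_iUnion₂.1 htS
    have hLpos : 0 < bary L p (γ t) := (hpos' t ht1.le).trans_le hle
    have e1 := hγc.continuousAt.eventually (star_mem_nhds hp hL htL hLpos)
    have e2 := hγc.continuousAt.eventually (T.eventually_mem_cell_imp (γ t))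
    filter_upwards [nhdsWithin_le_nhds e1, nhdsWithin_le_nhds e2, self_mem_nhdsWithin]
      with s h1 h2 h3
    obtain ⟨L', hL', -, hs⟩ := mem_star_iff.1 h1
    refine Set.mem_iUnion₂.2 ⟨L', hL', hs, ?_⟩
    have h4 := hM L' hL' (γ t) (γ s)
    rw [← hat_eq_bary hL' (h2 L' hL' hs), hat_eq_bary hL htL] at h4
    have h5 : dist (γ t) (γ s) = (s - t) * dist y z := by
      rw [hγ, dist_lineMap_lineMap, Real.dist_eq, abs_sub_comm,
        abs_of_pos (sub_pos.2 h3)]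
    rw [h5] at h4
    have h6 := (abs_le.1 h4).2
    linarith
  obtain ⟨L, hL, h1, h2⟩ := Set.mem_iUnion₂.1 (hsub (Set.right_mem_Icc.2 zero_le_one))
  have hz1 : γ 1 = z := by simp [hγ]
  rw [hz1] at h1 h2
  exact mem_star_iff.2 ⟨L, hL, hstar L hL z ((hpos' 1 le_rfl).trans_le h2), h1⟩

end Triangulation

namespace Triangulation

variable {Ω : Set (Eucl d)} {T : Triangulation Ω}

/-! ### Meshes of regular cells -/

variable (T) in
/-- Every cell has diameter at most `h` and contains a ball of radius `θ h`. -/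
structure IsRegularMesh (θ h : ℝ) : Prop where
  theta_pos : 0 < θ
  pos : 0 < h
  diam_le : ∀ K ∈ T.cells, diam (convexHull ℝ (K : Set (Eucl d))) ≤ h
  exists_closedBall : ∀ K ∈ T.cells, ∃ x, closedBall x (θ * h) ⊆ convexHull ℝ (K : Set (Eucl d))

theorem exists_mem_cells (hne : Ω.Nonempty) : ∃ K, K ∈ T.cells := by
  obtain ⟨x, hx⟩ := hne
  obtain ⟨K, hK, -⟩ := T.mem_closure_iff.1 (subset_closure hx)
  exact ⟨K, hK⟩

theorem exists_ne_mem_cell (hd : 0 < d) {K : Finset (Eucl d)} (hK : K ∈ T.cells) (p : Eucl d) :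
    ∃ q ∈ K, q ≠ p := by
  refine Finset.exists_mem_ne ?_ p
  rw [T.card_of_mem_cells hK]
  omega

theorem diam_cell_pos (hd : 0 < d) {K : Finset (Eucl d)} (hK : K ∈ T.cells) :
    0 < diam (convexHull ℝ (K : Set (Eucl d))) := by
  obtain ⟨p, hp, -⟩ := exists_ne_mem_cell hd hK 0
  obtain ⟨q, hq, hqp⟩ := exists_ne_mem_cell hd hK p
  exact (dist_pos.2 hqp).trans_le (dist_le_diam_of_mem (isBounded_cell K)
    (subset_convexHull ℝ _ hq) (subset_convexHull ℝ _ hp))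

/-- The maxima with 1 make the constant positive whatever the signs of `σ` and `τ`. -/
theorem isRegularMesh (hd : 0 < d) (hne : Ω.Nonempty) {σ τ h : ℝ} (hσ : T.IsShapeRegular σ)
    (hτ : T.IsQuasiUniform τ h) : T.IsRegularMesh (max σ 1 * max τ 1)⁻¹ h := by
  have hs : 0 < max σ 1 := lt_max_of_lt_right one_pos
  have ht : 0 < max τ 1 := lt_max_of_lt_right one_pos
  refine ⟨by positivity, ?_, fun K hK => (hτ K hK).1, fun K hK => ?_⟩
  · obtain ⟨K, hK⟩ := exists_mem_cells (T := T) hne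
    exact (diam_cell_pos hd hK).trans_le (hτ K hK).1
  · obtain ⟨x, ρ, hρ, hsub, hdiam⟩ := hσ K hK
    refine ⟨x, (closedBall_subset_closedBall ?_).trans hsub⟩
    rw [inv_mul_le_iff₀ (by positivity)]
    calc h ≤ τ * diam (convexHull ℝ (K : Set (Eucl d))) := (hτ K hK).2
      _ ≤ max τ 1 * diam (convexHull ℝ (K : Set (Eucl d))) :=
        mul_le_mul_of_nonneg_right (le_max_left _ _) diam_nonneg
      _ ≤ max τ 1 * (max σ 1 * ρ) := mul_le_mul_of_nonneg_left
        (hdiam.trans (mul_le_mul_of_nonneg_right (le_max_left _ _) hρ.le)) ht.le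
      _ = max σ 1 * max τ 1 * ρ := by ring

theorem IsRegularMesh.dist_le {θ h : ℝ} (hT : T.IsRegularMesh θ h)
    {K : Finset (Eucl d)} (hK : K ∈ T.cells) {x y : Eucl d}
    (hx : x ∈ convexHull ℝ (K : Set (Eucl d))) (hy : y ∈ convexHull ℝ (K : Set (Eucl d))) :
    dist x y ≤ h :=
  (dist_le_diam_of_mem (isBounded_cell K) hx hy).trans (hT.diam_le K hK)

/-- A barycentric coordinate lies in [0,1] on a ball of radius θh in the cell, so its linear part
changes by at most 1 over a displacement of length θh. -/
theorem IsRegularMesh.abs_bary_sub_le {θ h : ℝ} (hT : T.IsRegularMesh θ h)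
    {K : Finset (Eucl d)} (hK : K ∈ T.cells)
    (p u v : Eucl d) : |bary K p u - bary K p v| ≤ (θ * h)⁻¹ * dist u v := by
  have hr : 0 < θ * h := mul_pos hT.theta_pos hT.pos
  rcases eq_or_ne u v with rfl | huv
  · simp
  obtain ⟨c, hc⟩ := hT.exists_closedBall K hK
  have hD : 0 < dist u v := dist_pos.2 huv
  set s := θ * h / dist u v with hs
  have hs0 : 0 < s := div_pos hr hD
  have hmem : s • (u - v) + c ∈ convexHull ℝ (K : Set (Eucl d)) := by
    refine hc ?_
    rw [mem_closedBall, dist_eq_norm, add_sub_cancel_right, norm_smul, Real.norm_of_nonneg hs0.le,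
      ← dist_eq_norm, hs, div_mul_cancel₀ _ hD.ne']
  have hmem' : c ∈ convexHull ℝ (K : Set (Eucl d)) := hc (mem_closedBall_self hr.le)
  have h1 : bary K p (s • (u - v) + c) = s * (bary K p u - bary K p v) + bary K p c := by
    have e1 := (bary K p).map_vadd c (s • (u - v))
    have e2 := (bary K p).linearMap_vsub u v
    simp only [vadd_eq_add, map_smul, vsub_eq_sub, smul_eq_mul] at e1 e2
    rw [e1, e2]
  have h2 : |s * (bary K p u - bary K p v)| ≤ 1 := by
    rw [abs_le]
    have b1 := bary_nonneg hK hmem p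
    have b2 := bary_le_one hK hmem p
    have b3 := bary_nonneg hK hmem' p
    have b4 := bary_le_one hK hmem' p
    constructor <;> linarith
  rw [abs_mul, abs_of_pos hs0, hs, div_mul_eq_mul_div, div_le_one hD] at h2
  rw [inv_mul_eq_div, le_div_iff₀ hr]
  linarith

/-- In the inner half ball of a cell all barycentric coordinates are bounded below. -/
theorem IsRegularMesh.exists_ball_le_bary {θ h : ℝ} (hT : T.IsRegularMesh θ h) (hd : 0 < d)
    {K : Finset (Eucl d)} (hK : K ∈ T.cells) :
    ∃ x, ball x (θ * h / 2) ⊆ interior (convexHull ℝ (K : Set (Eucl d))) ∧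
      ∀ z ∈ ball x (θ * h / 2), ∀ p ∈ K, θ / 2 ≤ bary K p z := by
  have hθ := hT.theta_pos
  have hh := hT.pos
  have hr : 0 < θ * h := mul_pos hθ hh
  obtain ⟨c, hc⟩ := hT.exists_closedBall K hK
  refine ⟨c, interior_maximal (((ball_subset_ball (by linarith)).trans ball_subset_closedBall).trans
    hc) isOpen_ball, fun z hz p hp => ?_⟩
  obtain ⟨q, hq, hqp⟩ := exists_ne_mem_cell hd hK p
  have hD : 0 < dist q p := dist_pos.2 hqp
  have hDh : dist q p ≤ h := hT.dist_le hK (subset_convexHull ℝ _ hq) (subset_convexHull ℝ _ hp)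
  set t := θ * h / 2 / dist q p with ht
  have ht0 : 0 < t := by positivity
  -- A step of length θh/2 in the direction from `p` to another vertex `q` stays in the cell and
  -- lowers the coordinate at `p` by exactly t, so this coordinate was at least t.
  have hle : θ / 2 ≤ t := by
    rw [ht, le_div_iff₀ hD]
    nlinarith
  have hmem : t • (q - p) + z ∈ convexHull ℝ (K : Set (Eucl d)) := by
    refine hc ?_
    rw [mem_closedBall]
    calc dist (t • (q - p) + z) c ≤ dist (t • (q - p) + z) z + dist z c := dist_triangle _ _ _
      _ ≤ θ * h / 2 + θ * h / 2 := by
        refine add_le_add ?_ (mem_ball.1 hz).le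
        rw [dist_eq_norm, add_sub_cancel_right, norm_smul, Real.norm_of_nonneg ht0.le,
          ← dist_eq_norm, ht, div_mul_cancel₀ _ hD.ne']
      _ = θ * h := by ring
  have h1 : bary K p (t • (q - p) + z) = bary K p z - t := by
    have e1 := (bary K p).map_vadd z (t • (q - p))
    have e2 := (bary K p).linearMap_vsub q p
    simp only [vadd_eq_add, map_smul, vsub_eq_sub, smul_eq_mul] at e1 e2
    rw [e1, e2, bary_self hK hp, bary_ne hK hq hqp.symm]
    ring
  have h2 := bary_nonneg hK hmem p
  linarith

/-! ### Volumes -/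

theorem volume_real_ball (x : Eucl d) {r : ℝ} (hr : 0 < r) :
    volume.real (ball x r) = r ^ d * volume.real (ball (0 : Eucl d) 1) := by
  rw [Measure.real, Measure.addHaar_ball_of_pos _ _ hr, ENNReal.toReal_mul,
    ENNReal.toReal_ofReal (by positivity), finrank_euclideanSpace_fin]
  rfl

theorem volume_real_closedBall (x : Eucl d) {r : ℝ} (hr : 0 ≤ r) :
    volume.real (closedBall x r) = r ^ d * volume.real (ball (0 : Eucl d) 1) := by
  rw [Measure.real, Measure.addHaar_closedBall _ _ hr, ENNReal.toReal_mul,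
    ENNReal.toReal_ofReal (by positivity), finrank_euclideanSpace_fin]
  rfl

theorem volume_real_unitBall_pos : 0 < volume.real (ball (0 : Eucl d) 1) :=
  ENNReal.toReal_pos (measure_ball_pos _ _ one_pos).ne' measure_ball_lt_top.ne

theorem interior_ae_eq_cell (K : Finset (Eucl d)) :
    (interior (convexHull ℝ (K : Set (Eucl d))) : Set (Eucl d)) =ᵐ[volume]
      convexHull ℝ (K : Set (Eucl d)) :=
  interior_ae_eq_of_null_frontier ((convex_convexHull ℝ _).addHaar_frontier volume)

theorem pairwise_disjoint_interior {s : Finset (Finset (Eucl d))} (hs : s ⊆ T.cells) :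
    (s : Set (Finset (Eucl d))).PairwiseDisjoint
      fun K => interior (convexHull ℝ (K : Set (Eucl d))) :=
  fun _ hK _ hL hKL => disjoint_interior (hs hK) (hs hL) hKL

theorem volume_interior_lt_top (K : Finset (Eucl d)) :
    volume (interior (convexHull ℝ (K : Set (Eucl d)))) < ⊤ :=
  ((isBounded_cell K).subset interior_subset).measure_lt_top

theorem IsRegularMesh.volume_interior_le {θ h : ℝ} (hT : T.IsRegularMesh θ h)
    {K : Finset (Eucl d)} (hK : K ∈ T.cells) :
    volume.real (interior (convexHull ℝ (K : Set (Eucl d)))) ≤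
      h ^ d * volume.real (ball (0 : Eucl d) 1) := by
  obtain ⟨c, hc⟩ := hT.exists_closedBall K hK
  have hcK := hc (mem_closedBall_self (mul_pos hT.theta_pos hT.pos).le)
  rw [← volume_real_closedBall c hT.pos.le]
  exact measureReal_mono (fun x hx => mem_closedBall.2 (hT.dist_le hK (interior_subset hx) hcK))
    measure_closedBall_lt_top.ne

/-- The number of cells in a ball of radius `R h` is bounded. -/
theorem IsRegularMesh.card_le {θ h : ℝ} (hT : T.IsRegularMesh θ h) {s : Finset (Finset (Eucl d))}
    (hs : s ⊆ T.cells) {x : Eucl d} {R : ℝ} (hR : 0 ≤ R)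
    (hsub : ∀ K ∈ s, convexHull ℝ (K : Set (Eucl d)) ⊆ closedBall x (R * h)) :
    (s.card : ℝ) ≤ (R / θ) ^ d := by
  have hθ := hT.theta_pos
  have hh := hT.pos
  have hv := volume_real_unitBall_pos (d := d)
  have h1 : ∀ K ∈ s, (θ * h) ^ d * volume.real (ball (0 : Eucl d) 1) ≤
      volume.real (interior (convexHull ℝ (K : Set (Eucl d)))) := by
    intro K hK
    obtain ⟨c, hc⟩ := hT.exists_closedBall K (hs hK)
    rw [← volume_real_ball c (by positivity)]
    exact measureReal_mono (interior_maximal (ball_subset_closedBall.trans hc) isOpen_ball)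
      (volume_interior_lt_top K).ne
  have h2 : ∑ K ∈ s, volume.real (interior (convexHull ℝ (K : Set (Eucl d)))) ≤
      (R * h) ^ d * volume.real (ball (0 : Eucl d) 1) := by
    rw [← measureReal_biUnion_finset (pairwise_disjoint_interior hs)
      (fun _ _ => isOpen_interior.measurableSet) (fun K _ => (volume_interior_lt_top K).ne),
      ← volume_real_closedBall x (by positivity)]
    exact measureReal_mono (Set.iUnion₂_subset fun K hK => interior_subset.trans (hsub K hK))
      measure_closedBall_lt_top.ne
  have h3 := (Finset.card_nsmul_le_sum s _ _ h1).trans h2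
  rw [nsmul_eq_mul, ← mul_assoc] at h3
  have h4 := le_of_mul_le_mul_right h3 hv
  rw [mul_pow, mul_pow] at h4
  rw [div_pow, le_div_iff₀ (by positivity)]
  have h5 : (0 : ℝ) < h ^ d := by positivity
  nlinarith

/-! ### The extended domain as a union of cells -/

variable {Ωk : Set (Eucl d)} {δ : ℝ}

theorem mem_subCells {K : Finset (Eucl d)} : K ∈ T.subCells Ωk δ ↔
    K ∈ T.cells ∧ ∃ x ∈ convexHull ℝ (K : Set (Eucl d)), infDist x Ωk ≤ δ := by
  classical
  exact Finset.mem_filter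

theorem subCells_subset : T.subCells Ωk δ ⊆ T.cells := fun _ h => (mem_subCells.1 h).1

theorem interior_subset_extDomain {K : Finset (Eucl d)} (hK : K ∈ T.subCells Ωk δ) :
    interior (convexHull ℝ (K : Set (Eucl d))) ⊆ T.extDomain Ωk δ :=
  interior_mono (Set.subset_iUnion₂_of_subset K hK subset_rfl)

theorem exists_cell_of_mem_extDomain {x : Eucl d} (hx : x ∈ T.extDomain Ωk δ) :
    ∃ K ∈ T.subCells Ωk δ, x ∈ convexHull ℝ (K : Set (Eucl d)) := by
  obtain ⟨K, hK, hxK⟩ := Set.mem_iUnion₂.1 (interior_subset hx)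
  exact ⟨K, hK, hxK⟩

theorem extDomain_subset_closure : T.extDomain Ωk δ ⊆ closure Ω := fun _ hx => by
  obtain ⟨K, hK, hxK⟩ := exists_cell_of_mem_extDomain hx
  exact convexHull_subset_closure (subCells_subset hK) hxK

theorem measurableSet_extDomain : MeasurableSet (T.extDomain Ωk δ) :=
  isOpen_interior.measurableSet

theorem volume_extDomain_lt_top : volume (T.extDomain Ωk δ) < ⊤ := by
  refine (Bornology.IsBounded.subset ?_ interior_subset).measure_lt_top
  exact (Bornology.isBounded_biUnion_finset _).2 fun K _ => isBounded_cell K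

/-- Boundaries of convex sets are null sets, so integrals over the extended domain split into
integrals over the disjoint open cells. -/
theorem extDomain_ae_eq : (T.extDomain Ωk δ : Set (Eucl d)) =ᵐ[volume]
    ⋃ K ∈ T.subCells Ωk δ, interior (convexHull ℝ (K : Set (Eucl d))) := by
  have h1 : (⋃ K ∈ T.subCells Ωk δ, interior (convexHull ℝ (K : Set (Eucl d))) :
      Set (Eucl d)) =ᵐ[volume] ⋃ K ∈ T.subCells Ωk δ, convexHull ℝ (K : Set (Eucl d)) :=
    Filter.EventuallyEq.countable_bUnion (T.subCells Ωk δ).countable_toSet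
      fun K _ => interior_ae_eq_cell K
  refine Filter.EventuallyLE.antisymm ?_ ?_
  · exact (LE.le.eventuallyLE interior_subset).trans h1.symm.le
  · exact LE.le.eventuallyLE (Set.iUnion₂_subset fun K hK => interior_subset_extDomain hK)

theorem setIntegral_extDomain {f : Eucl d → ℝ} (hf : IntegrableOn f (T.extDomain Ωk δ)) :
    ∫ x in T.extDomain Ωk δ, f x =
      ∑ K ∈ T.subCells Ωk δ, ∫ x in interior (convexHull ℝ (K : Set (Eucl d))), f x := by
  rw [setIntegral_congr_set extDomain_ae_eq]
  exact integral_biUnion_finset _ (fun _ _ => isOpen_interior.measurableSet)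
    (pairwise_disjoint_interior subCells_subset)
    (fun K hK => hf.mono_set (interior_subset_extDomain hK))

theorem subset_extDomain (hΩk : IsOpen Ωk) (hsub : Ωk ⊆ Ω) (hδ : 0 ≤ δ) :
    Ωk ⊆ T.extDomain Ωk δ := by
  refine interior_maximal (fun x hx => ?_) hΩk
  obtain ⟨K, hK, hxK⟩ := T.mem_closure_iff.1 (subset_closure (hsub hx))
  exact Set.mem_iUnion₂.2 ⟨K, mem_subCells.2 ⟨hK, x, hxK, by rwa [infDist_zero_of_mem hx]⟩, hxK⟩

end Triangulation

namespace Triangulation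

variable {Ω : Set (Eucl d)} {T : Triangulation Ω} {Ωk : Set (Eucl d)} {δ : ℝ}

/-! ### The stabilization form as a sum of weighted deviations -/

theorem hat_nonneg {x : Eucl d} (hx : x ∈ closure Ω) (p : Eucl d) : 0 ≤ T.hat p x := by
  obtain ⟨K, hK, hxK⟩ := T.mem_closure_iff.1 hx
  rw [hat_eq_bary hK hxK]
  exact bary_nonneg hK hxK p

theorem hat_le_one {x : Eucl d} (hx : x ∈ closure Ω) (p : Eucl d) : T.hat p x ≤ 1 := by
  obtain ⟨K, hK, hxK⟩ := T.mem_closure_iff.1 hx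
  rw [hat_eq_bary hK hxK]
  exact bary_le_one hK hxK p

theorem continuousOn_hat (p : Eucl d) : ContinuousOn (T.hat p) (closure Ω) := by
  have h := (locallyFinite_of_finite fun K : T.cells =>
    convexHull ℝ ((K : Finset (Eucl d)) : Set (Eucl d))).continuousOn_iUnion (g := T.hat p)
    (fun K => isClosed_cell K.1)
    (fun K => ((continuous_bary K p).continuousOn).congr fun x hx => hat_eq_bary K.2 hx p)
  refine h.mono fun x hx => ?_
  obtain ⟨K, hK, hxK⟩ := T.mem_closure_iff.1 hx
  exact Set.mem_iUnion.2 ⟨⟨K, hK⟩, hxK⟩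

theorem aestronglyMeasurable_hat (p : Eucl d) :
    AEStronglyMeasurable (T.hat p) (volume.restrict (T.extDomain Ωk δ)) :=
  ((continuousOn_hat p).mono extDomain_subset_closure).aestronglyMeasurable
    measurableSet_extDomain

theorem ae_norm_hat_le (p : Eucl d) :
    ∀ᵐ x ∂volume.restrict (T.extDomain Ωk δ), ‖T.hat p x‖ ≤ 1 := by
  filter_upwards [ae_restrict_mem measurableSet_extDomain] with x hx
  have hx' := extDomain_subset_closure hx
  rw [Real.norm_of_nonneg (hat_nonneg hx' p)]
  exact hat_le_one hx' p

theorem integrableOn_hat_mul {f : Eucl d → ℝ} (hf : IntegrableOn f (T.extDomain Ωk δ))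
    (p : Eucl d) : IntegrableOn (fun x => T.hat p x * f x) (T.extDomain Ωk δ) :=
  Integrable.bdd_mul hf (aestronglyMeasurable_hat p) (ae_norm_hat_le p)

theorem integrableOn_hat_smul {f : Eucl d → Eucl d} (hf : IntegrableOn f (T.extDomain Ωk δ))
    (p : Eucl d) : IntegrableOn (fun x => T.hat p x • f x) (T.extDomain Ωk δ) :=
  Integrable.bdd_smul hf 1 (aestronglyMeasurable_hat p) (ae_norm_hat_le p)

theorem integrableOn_const_extDomain (c : ℝ) :
    IntegrableOn (fun _ => c) (T.extDomain Ωk δ) :=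
  integrableOn_const volume_extDomain_lt_top.ne

variable (T Ωk δ) in
open Classical in
/-- All vertices of the sub-triangulation. -/
def vertices : Finset (Eucl d) := (T.subCells Ωk δ).biUnion id

theorem mem_vertices {K : Finset (Eucl d)} (hK : K ∈ T.subCells Ωk δ) {p : Eucl d} (hp : p ∈ K) :
    p ∈ T.vertices Ωk δ := by
  classical
  exact Finset.mem_biUnion.2 ⟨K, hK, hp⟩

theorem sum_vertices_hat_mul {K : Finset (Eucl d)} (hK : K ∈ T.subCells Ωk δ) {x : Eucl d}
    (hx : x ∈ convexHull ℝ (K : Set (Eucl d))) (f : Eucl d → ℝ) :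
    ∑ p ∈ T.vertices Ωk δ, T.hat p x * f p = ∑ p ∈ K, bary K p x * f p := by
  have hKc := subCells_subset hK
  simp_rw [hat_eq_bary hKc hx]
  symm
  refine Finset.sum_subset (fun p hp => mem_vertices hK hp) fun p _ hp => ?_
  rw [bary_of_notMem hp, zero_mul]

open Classical in
variable (T Ωk δ) in
/-- The nodal values of the lumped projection, with the value zero at the vertices on `∂Ω`. -/
def nodeVal (G : Eucl d → Eucl d) (p : Eucl d) : Eucl d :=
  if p ∈ T.nodes Ωk δ then T.coeff Ωk δ G p else 0

theorem nodeVal_of_mem_frontier (G : Eucl d → Eucl d) {p : Eucl d} (hp : p ∈ frontier Ω) :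
    T.nodeVal Ωk δ G p = 0 := by
  classical
  refine if_neg fun h => ?_
  rw [nodes, Finset.mem_filter] at h
  exact h.2 hp

variable (T Ωk δ) in
/-- The density of the stabilization energy: the weighted deviations of `G` from its nodal
values. -/
def energy (G : Eucl d → Eucl d) (x : Eucl d) : ℝ :=
  ∑ p ∈ T.vertices Ωk δ, T.hat p x * ‖G x - T.nodeVal Ωk δ G p‖ ^ 2

theorem proj_eq (G : Eucl d → Eucl d) (x : Eucl d) :
    T.proj Ωk δ G x = ∑ p ∈ T.vertices Ωk δ, T.hat p x • T.nodeVal Ωk δ G p := by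
  classical
  have hsub : T.nodes Ωk δ ⊆ T.vertices Ωk δ := Finset.filter_subset _ _
  rw [proj, ← Finset.sum_subset hsub]
  · exact Finset.sum_congr rfl fun p hp => by rw [nodeVal, if_pos hp]
  · intro p _ hp
    rw [nodeVal, if_neg hp, smul_zero]

section L2

variable {G : Eucl d → Eucl d}

theorem integrableOn_of_memLp (hG : MemLp G 2 (volume.restrict (T.extDomain Ωk δ))) :
    IntegrableOn G (T.extDomain Ωk δ) := by
  have : IsFiniteMeasure (volume.restrict (T.extDomain Ωk δ)) :=
    ⟨by rw [Measure.restrict_apply_univ]; exact volume_extDomain_lt_top⟩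
  exact hG.integrable (by norm_num)

theorem integrableOn_norm_sub_sq (hG : MemLp G 2 (volume.restrict (T.extDomain Ωk δ)))
    (c : Eucl d) : IntegrableOn (fun x => ‖G x - c‖ ^ 2) (T.extDomain Ωk δ) := by
  have : IsFiniteMeasure (volume.restrict (T.extDomain Ωk δ)) :=
    ⟨by rw [Measure.restrict_apply_univ]; exact volume_extDomain_lt_top⟩
  exact (hG.sub (memLp_const c)).integrable_norm_pow (by norm_num)

theorem integrableOn_norm_sq (hG : MemLp G 2 (volume.restrict (T.extDomain Ωk δ))) :
    IntegrableOn (fun x => ‖G x‖ ^ 2) (T.extDomain Ωk δ) := by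
  simpa using integrableOn_norm_sub_sq hG 0

theorem integrableOn_energy (hG : MemLp G 2 (volume.restrict (T.extDomain Ωk δ))) :
    IntegrableOn (T.energy Ωk δ G) (T.extDomain Ωk δ) :=
  integrable_finsetSum _ fun p _ => integrableOn_hat_mul (integrableOn_norm_sub_sq hG _) p

/-- Orthogonality behind the lumped projection: with m = ∫ φ_p and I = ∫ φ_p G, the nodal value I/m
satisfies ⟪I/m, I⟫ = m |I/m|². At vertices on ∂Ω both sides are zero. -/
theorem integral_hat_mul_inner (hG : MemLp G 2 (volume.restrict (T.extDomain Ωk δ)))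
    (p : Eucl d) :
    ∫ x in T.extDomain Ωk δ, T.hat p x * ⟪T.nodeVal Ωk δ G p, G x⟫ =
      ∫ x in T.extDomain Ωk δ, T.hat p x * ‖T.nodeVal Ωk δ G p‖ ^ 2 := by
  classical
  have h1 : ∀ c : Eucl d, ∫ x in T.extDomain Ωk δ, T.hat p x * ⟪c, G x⟫ =
      ⟪c, ∫ x in T.extDomain Ωk δ, T.hat p x • G x⟫ := by
    intro c
    rw [← integral_inner (integrableOn_hat_smul (integrableOn_of_memLp hG) p)]
    simp_rw [real_inner_smul_right]
  rw [h1, integral_mul_const]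
  by_cases hp : p ∈ T.nodes Ωk δ
  · rw [nodeVal, if_pos hp, coeff]
    set m := ∫ x in T.extDomain Ωk δ, T.hat p x
    set I := ∫ x in T.extDomain Ωk δ, T.hat p x • G x
    rw [real_inner_smul_left, real_inner_self_eq_norm_sq, norm_smul, mul_pow, norm_inv,
      Real.norm_eq_abs, inv_pow, sq_abs]
    rcases eq_or_ne m 0 with h0 | h0
    · simp [h0]
    · field_simp
  · rw [nodeVal, if_neg hp]
    simp

/-- Expanding the squares and using that the hat functions sum to one leaves the integrand of the
form plus a bracket whose integral vanishes, vertex by vertex, by `integral_hat_mul_inner`. -/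
theorem stab_eq_integral_energy (hG : MemLp G 2 (volume.restrict (T.extDomain Ωk δ))) :
    T.stab Ωk δ G G = ∫ x in T.extDomain Ωk δ, T.energy Ωk δ G x := by
  have hin : ∀ c : Eucl d, IntegrableOn (fun x => ⟪c, G x⟫) (T.extDomain Ωk δ) := fun c =>
    (integrableOn_of_memLp hG).const_inner c
  have hi1 : ∀ p, IntegrableOn (fun x => T.hat p x * ⟪T.nodeVal Ωk δ G p, G x⟫)
      (T.extDomain Ωk δ) := fun p => integrableOn_hat_mul (hin _) p
  have hi2 : ∀ p, IntegrableOn (fun x => T.hat p x * ‖T.nodeVal Ωk δ G p‖ ^ 2)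
      (T.extDomain Ωk δ) := fun p =>
    integrableOn_hat_mul (f := fun _ => ‖T.nodeVal Ωk δ G p‖ ^ 2) (integrableOn_const_extDomain _) p
  have hs1 := integrable_finsetSum (T.vertices Ωk δ) fun p _ => hi1 p
  have hs2 := integrable_finsetSum (T.vertices Ωk δ) fun p _ => hi2 p
  have hs3 : Integrable (fun x => ∑ p ∈ T.vertices Ωk δ, T.hat p x * ‖T.nodeVal Ωk δ G p‖ ^ 2 -
      ∑ p ∈ T.vertices Ωk δ, T.hat p x * ⟪T.nodeVal Ωk δ G p, G x⟫)
      (volume.restrict (T.extDomain Ωk δ)) := hs2.sub hs1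
  have hpt : ∀ x ∈ T.extDomain Ωk δ, T.energy Ωk δ G x =
      ⟪G x - T.proj Ωk δ G x, G x⟫ +
      (∑ p ∈ T.vertices Ωk δ, T.hat p x * ‖T.nodeVal Ωk δ G p‖ ^ 2 -
        ∑ p ∈ T.vertices Ωk δ, T.hat p x * ⟪T.nodeVal Ωk δ G p, G x⟫) := by
    intro x hx
    obtain ⟨K, hK, hxK⟩ := exists_cell_of_mem_extDomain hx
    have hsum : ∑ p ∈ T.vertices Ωk δ, T.hat p x * ‖G x‖ ^ 2 = ‖G x‖ ^ 2 := by
      rw [sum_vertices_hat_mul hK hxK (fun _ => ‖G x‖ ^ 2), ← Finset.sum_mul,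
        sum_bary (subCells_subset hK), one_mul]
    rw [proj_eq, inner_sub_left, sum_inner, real_inner_self_eq_norm_sq, ← hsum, energy]
    simp_rw [real_inner_smul_left]
    rw [← Finset.sum_sub_distrib, ← Finset.sum_sub_distrib, ← Finset.sum_add_distrib]
    refine Finset.sum_congr rfl fun p _ => ?_
    rw [norm_sub_sq_real, real_inner_comm]
    ring
  rw [setIntegral_congr_fun measurableSet_extDomain hpt, integral_add ?_ hs3,
    integral_sub hs2 hs1, integral_finsetSum _ fun p _ => hi2 p,
    integral_finsetSum _ fun p _ => hi1 p]
  · simp_rw [integral_hat_mul_inner hG]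
    rw [sub_self, add_zero, stab]
  · have h3 := ((integrableOn_norm_sq hG).sub hs1)
    refine h3.congr (Filter.Eventually.of_forall fun x => ?_)
    simp only [Pi.sub_apply]
    rw [proj_eq, inner_sub_left, sum_inner, real_inner_self_eq_norm_sq]
    simp_rw [real_inner_smul_left]

end L2

theorem energy_nonneg (G : Eucl d → Eucl d) {x : Eucl d} (hx : x ∈ closure Ω) :
    0 ≤ T.energy Ωk δ G x :=
  Finset.sum_nonneg fun p _ => mul_nonneg (hat_nonneg hx p) (by positivity)

theorem energy_eq_on_cell (G : Eucl d → Eucl d) {K : Finset (Eucl d)}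
    (hK : K ∈ T.subCells Ωk δ) {x : Eucl d} (hx : x ∈ convexHull ℝ (K : Set (Eucl d))) :
    T.energy Ωk δ G x = ∑ p ∈ K, bary K p x * ‖G x - T.nodeVal Ωk δ G p‖ ^ 2 :=
  sum_vertices_hat_mul hK hx fun p => ‖G x - T.nodeVal Ωk δ G p‖ ^ 2

theorem bary_mul_le_energy (G : Eucl d → Eucl d) {K : Finset (Eucl d)}
    (hK : K ∈ T.subCells Ωk δ) {x : Eucl d} (hx : x ∈ convexHull ℝ (K : Set (Eucl d)))
    {p : Eucl d} (hp : p ∈ K) :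
    bary K p x * ‖G x - T.nodeVal Ωk δ G p‖ ^ 2 ≤ T.energy Ωk δ G x := by
  rw [energy_eq_on_cell G hK hx]
  exact Finset.single_le_sum (f := fun p => bary K p x * ‖G x - T.nodeVal Ωk δ G p‖ ^ 2)
    (fun q _ => mul_nonneg (bary_nonneg (subCells_subset hK) hx q) (by positivity)) hp

theorem norm_sq_le_two_mul_add {E : Type*} [SeminormedAddCommGroup E] (a b : E) :
    ‖a‖ ^ 2 ≤ 2 * ‖a - b‖ ^ 2 + 2 * ‖b‖ ^ 2 := by
  have h1 : ‖a‖ ≤ ‖a - b‖ + ‖b‖ := by simpa using norm_add_le (a - b) b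
  have h2 := norm_nonneg a
  nlinarith [sq_nonneg (‖a - b‖ - ‖b‖)]

/-! ### Estimates on a single cell -/

section Cell

variable {G : Eucl d → Eucl d} {K : Finset (Eucl d)}

theorem integrableOn_cell {f : Eucl d → ℝ} (hf : IntegrableOn f (T.extDomain Ωk δ))
    (hK : K ∈ T.subCells Ωk δ) : IntegrableOn f (interior (convexHull ℝ (K : Set (Eucl d)))) :=
  hf.mono_set (interior_subset_extDomain hK)

theorem cell_integral_energy_nonneg (G : Eucl d → Eucl d) (hK : K ∈ T.subCells Ωk δ) :
    0 ≤ ∫ x in interior (convexHull ℝ (K : Set (Eucl d))), T.energy Ωk δ G x :=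
  setIntegral_nonneg isOpen_interior.measurableSet fun _ hx => energy_nonneg G
    (convexHull_subset_closure (subCells_subset hK) (interior_subset hx))

/-- On a ball of radius θh/2 in the cell all weights are at least θ/2, so both deviations |G − g_p|²
and |G − g_q|² are at most 2/θ times the energy density; the triangle inequality gives the factor
8/θ. -/
theorem norm_nodeVal_sub_sq_le (hd : 0 < d) {θ h : ℝ} (hT : T.IsRegularMesh θ h)
    (hG : MemLp G 2 (volume.restrict (T.extDomain Ωk δ))) (hK : K ∈ T.subCells Ωk δ)
    {p q : Eucl d} (hp : p ∈ K) (hq : q ∈ K) :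
    (θ * h / 2) ^ d * volume.real (ball (0 : Eucl d) 1) *
        ‖T.nodeVal Ωk δ G p - T.nodeVal Ωk δ G q‖ ^ 2 ≤
      8 / θ * ∫ x in interior (convexHull ℝ (K : Set (Eucl d))), T.energy Ωk δ G x := by
  have hθ := hT.theta_pos
  have hh := hT.pos
  have hKc := subCells_subset hK
  obtain ⟨c, hc, hlow⟩ := hT.exists_ball_le_bary hd hKc
  have hint := integrableOn_cell (integrableOn_energy hG) hK
  have hpt : ∀ x ∈ ball c (θ * h / 2), ‖T.nodeVal Ωk δ G p - T.nodeVal Ωk δ G q‖ ^ 2 ≤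
      8 / θ * T.energy Ωk δ G x := by
    intro x hx
    have hxK := interior_subset (hc hx)
    have h1 := bary_mul_le_energy G hK hxK hp
    have h2 := bary_mul_le_energy G hK hxK hq
    have h3 := mul_le_mul_of_nonneg_right (hlow x hx p hp)
      (sq_nonneg ‖G x - T.nodeVal Ωk δ G p‖)
    have h4 := mul_le_mul_of_nonneg_right (hlow x hx q hq)
      (sq_nonneg ‖G x - T.nodeVal Ωk δ G q‖)
    have h5 := norm_sq_le_two_mul_add (T.nodeVal Ωk δ G p - T.nodeVal Ωk δ G q)
      (G x - T.nodeVal Ωk δ G q)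
    rw [show T.nodeVal Ωk δ G p - T.nodeVal Ωk δ G q - (G x - T.nodeVal Ωk δ G q) =
      -(G x - T.nodeVal Ωk δ G p) by abel, norm_neg] at h5
    rw [div_mul_eq_mul_div, le_div_iff₀ hθ]
    nlinarith
  calc (θ * h / 2) ^ d * volume.real (ball (0 : Eucl d) 1) *
        ‖T.nodeVal Ωk δ G p - T.nodeVal Ωk δ G q‖ ^ 2
      = ∫ _ in ball c (θ * h / 2), ‖T.nodeVal Ωk δ G p - T.nodeVal Ωk δ G q‖ ^ 2 := by
        rw [setIntegral_const, volume_real_ball c (by positivity), smul_eq_mul]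
    _ ≤ ∫ x in ball c (θ * h / 2), 8 / θ * T.energy Ωk δ G x :=
        setIntegral_mono_on (integrableOn_const measure_ball_lt_top.ne)
          ((hint.mono_set hc).const_mul _) measurableSet_ball hpt
    _ = 8 / θ * ∫ x in ball c (θ * h / 2), T.energy Ωk δ G x := integral_const_mul _ _
    _ ≤ 8 / θ * ∫ x in interior (convexHull ℝ (K : Set (Eucl d))), T.energy Ωk δ G x := by
        refine mul_le_mul_of_nonneg_left ?_ (by positivity)
        refine setIntegral_mono_set hint ?_ (LE.le.eventuallyLE hc)
        filter_upwards [ae_restrict_mem isOpen_interior.measurableSet] with x hx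
        exact energy_nonneg G (convexHull_subset_closure hKc (interior_subset hx))

/-- Some nodal value of a cell is controlled by the part of the cell in `Ωk`. -/
theorem exists_norm_nodeVal_sq_le (hG : MemLp G 2 (volume.restrict (T.extDomain Ωk δ)))
    (hΩk : IsOpen Ωk) (hK : K ∈ T.subCells Ωk δ) :
    ∃ q ∈ K, volume.real (interior (convexHull ℝ (K : Set (Eucl d))) ∩ Ωk) *
        ‖T.nodeVal Ωk δ G q‖ ^ 2 ≤
      2 * (∫ x in interior (convexHull ℝ (K : Set (Eucl d))), T.energy Ωk δ G x) +
      2 * ∫ x in interior (convexHull ℝ (K : Set (Eucl d))) ∩ Ωk, ‖G x‖ ^ 2 := by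
  have hKc := subCells_subset hK
  have hKne : K.Nonempty := Finset.card_pos.1 (by rw [T.card_of_mem_cells hKc]; omega)
  -- The smallest nodal value is below every barycentric average of the nodal values, so no lower
  -- bound on the weights is needed where Ωk cuts the cell.
  obtain ⟨q, hq, hmin⟩ := K.exists_min_image (fun q => ‖T.nodeVal Ωk δ G q‖ ^ 2) hKne
  refine ⟨q, hq, ?_⟩
  have hint := integrableOn_cell (integrableOn_energy hG) hK
  have hint2 := integrableOn_cell (integrableOn_norm_sq hG) hK
  set S := interior (convexHull ℝ (K : Set (Eucl d))) ∩ Ωk with hS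
  have hSm : MeasurableSet S := isOpen_interior.measurableSet.inter hΩk.measurableSet
  have hSK : S ⊆ interior (convexHull ℝ (K : Set (Eucl d))) := Set.inter_subset_left
  have hintS : IntegrableOn (fun x => 2 * T.energy Ωk δ G x + 2 * ‖G x‖ ^ 2) S :=
    Integrable.fun_add ((hint.mono_set hSK).const_mul 2) ((hint2.mono_set hSK).const_mul 2)
  have hpt : ∀ x ∈ S, ‖T.nodeVal Ωk δ G q‖ ^ 2 ≤
      2 * T.energy Ωk δ G x + 2 * ‖G x‖ ^ 2 := by
    intro x hx
    have hxK := interior_subset (hSK hx)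
    rw [energy_eq_on_cell G hK hxK]
    calc ‖T.nodeVal Ωk δ G q‖ ^ 2 = ∑ p ∈ K, bary K p x * ‖T.nodeVal Ωk δ G q‖ ^ 2 := by
          rw [← Finset.sum_mul, sum_bary hKc, one_mul]
      _ ≤ ∑ p ∈ K, bary K p x *
          (2 * ‖G x - T.nodeVal Ωk δ G p‖ ^ 2 + 2 * ‖G x‖ ^ 2) := by
          refine Finset.sum_le_sum fun p hp =>
            mul_le_mul_of_nonneg_left ((hmin p hp).trans ?_) (bary_nonneg hKc hxK p)
          rw [norm_sub_rev]
          exact norm_sq_le_two_mul_add _ _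
      _ = _ := by
          simp_rw [mul_add]
          rw [Finset.sum_add_distrib, ← Finset.sum_mul, sum_bary hKc, one_mul, Finset.mul_sum]
          congr 1
          exact Finset.sum_congr rfl fun p _ => by ring
  calc volume.real S * ‖T.nodeVal Ωk δ G q‖ ^ 2 = ∫ _ in S, ‖T.nodeVal Ωk δ G q‖ ^ 2 := by
        rw [setIntegral_const, smul_eq_mul]
    _ ≤ ∫ x in S, (2 * T.energy Ωk δ G x + 2 * ‖G x‖ ^ 2) :=
        setIntegral_mono_on
          (integrableOn_const ((measure_mono hSK).trans_lt (volume_interior_lt_top K)).ne)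
          hintS hSm hpt
    _ = 2 * (∫ x in S, T.energy Ωk δ G x) + 2 * ∫ x in S, ‖G x‖ ^ 2 := by
        rw [integral_add ((hint.mono_set hSK).const_mul _) ((hint2.mono_set hSK).const_mul _),
          integral_const_mul, integral_const_mul]
    _ ≤ _ := by
        gcongr
        · filter_upwards [ae_restrict_mem isOpen_interior.measurableSet] with x hx
          exact energy_nonneg G (convexHull_subset_closure hKc (interior_subset hx))

theorem cell_integral_norm_sq_le {θ h : ℝ} (hT : T.IsRegularMesh θ h)
    (hG : MemLp G 2 (volume.restrict (T.extDomain Ωk δ))) (hK : K ∈ T.subCells Ωk δ)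
    {B : ℝ} (hB0 : 0 ≤ B) (hB : ∀ p ∈ K, ‖T.nodeVal Ωk δ G p‖ ^ 2 ≤ B) :
    ∫ x in interior (convexHull ℝ (K : Set (Eucl d))), ‖G x‖ ^ 2 ≤
      2 * (∫ x in interior (convexHull ℝ (K : Set (Eucl d))), T.energy Ωk δ G x) +
      2 * (h ^ d * volume.real (ball (0 : Eucl d) 1) * B) := by
  have hKc := subCells_subset hK
  have hint := integrableOn_cell (integrableOn_energy hG) hK
  have hint2 := integrableOn_cell (integrableOn_norm_sq hG) hK
  have hpt : ∀ x ∈ interior (convexHull ℝ (K : Set (Eucl d))), ‖G x‖ ^ 2 ≤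
      2 * T.energy Ωk δ G x + 2 * B := by
    intro x hx
    have hxK := interior_subset hx
    rw [energy_eq_on_cell G hK hxK]
    calc ‖G x‖ ^ 2 = ∑ p ∈ K, bary K p x * ‖G x‖ ^ 2 := by
          rw [← Finset.sum_mul, sum_bary hKc, one_mul]
      _ ≤ ∑ p ∈ K, bary K p x * (2 * ‖G x - T.nodeVal Ωk δ G p‖ ^ 2 + 2 * B) := by
          refine Finset.sum_le_sum fun p hp =>
            mul_le_mul_of_nonneg_left ?_ (bary_nonneg hKc hxK p)
          have := norm_sq_le_two_mul_add (G x) (T.nodeVal Ωk δ G p)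
          linarith [hB p hp]
      _ = _ := by
          simp_rw [mul_add]
          rw [Finset.sum_add_distrib, ← Finset.sum_mul, sum_bary hKc, one_mul, Finset.mul_sum]
          congr 1
          exact Finset.sum_congr rfl fun p _ => by ring
  have hc : IntegrableOn (fun _ => 2 * B) (interior (convexHull ℝ (K : Set (Eucl d)))) :=
    integrableOn_const (volume_interior_lt_top K).ne
  calc ∫ x in interior (convexHull ℝ (K : Set (Eucl d))), ‖G x‖ ^ 2
      ≤ ∫ x in interior (convexHull ℝ (K : Set (Eucl d))), (2 * T.energy Ωk δ G x + 2 * B) :=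
        setIntegral_mono_on hint2 ((hint.const_mul _).add hc) isOpen_interior.measurableSet hpt
    _ = 2 * (∫ x in interior (convexHull ℝ (K : Set (Eucl d))), T.energy Ωk δ G x) +
        2 * (volume.real (interior (convexHull ℝ (K : Set (Eucl d)))) * B) := by
        rw [integral_add (hint.const_mul _) hc, integral_const_mul, setIntegral_const, smul_eq_mul]
        ring
    _ ≤ _ := by
        have := mul_le_mul_of_nonneg_right (hT.volume_interior_le hKc) hB0
        linarith

end Cell

end Triangulation

namespace Triangulation

variable {Ω : Set (Eucl d)} {T : Triangulation Ω} {Ωk : Set (Eucl d)} {δ : ℝ}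

/-! ### Chains of cells from a cell of the extended mesh to `Ωk` or to `∂Ω` -/

open Classical in
variable (T Ωk δ) in
/-- The cells of the sub-triangulation at distance at most `r` from the cell `K`. -/
def neighbors (r : ℝ) (K : Finset (Eucl d)) : Finset (Finset (Eucl d)) :=
  {L ∈ T.subCells Ωk δ | ∃ a ∈ convexHull ℝ (K : Set (Eucl d)),
    ∃ b ∈ convexHull ℝ (L : Set (Eucl d)), dist a b ≤ r}

theorem mem_neighbors {r : ℝ} {K L : Finset (Eucl d)} : L ∈ T.neighbors Ωk δ r K ↔
    L ∈ T.subCells Ωk δ ∧ ∃ a ∈ convexHull ℝ (K : Set (Eucl d)),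
      ∃ b ∈ convexHull ℝ (L : Set (Eucl d)), dist a b ≤ r := by
  classical
  exact Finset.mem_filter

theorem mem_neighbors_comm {r : ℝ} {K L : Finset (Eucl d)} (hK : K ∈ T.subCells Ωk δ)
    (h : L ∈ T.neighbors Ωk δ r K) : K ∈ T.neighbors Ωk δ r L := by
  obtain ⟨-, a, ha, b, hb, hab⟩ := mem_neighbors.1 h
  exact mem_neighbors.2 ⟨hK, b, hb, a, ha, by rwa [dist_comm]⟩

/-- All these cells lie in a ball of radius (C+3)h: the gap (C+1)h plus the diameters of both cells.
-/
theorem IsRegularMesh.card_neighbors_le {θ h : ℝ} (hT : T.IsRegularMesh θ h) {C : ℝ}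
    (hC : 0 ≤ C) {K : Finset (Eucl d)} (hK : K ∈ T.cells) :
    ((T.neighbors Ωk δ ((C + 1) * h) K).card : ℝ) ≤ ((C + 3) / θ) ^ d := by
  obtain ⟨x, hx⟩ := hT.exists_closedBall K hK
  have hxK := hx (mem_closedBall_self (mul_pos hT.theta_pos hT.pos).le)
  refine hT.card_le (x := x) (fun L hL => subCells_subset (mem_neighbors.1 hL).1) (by linarith)
    fun L hL z hz => ?_
  obtain ⟨hLs, a, ha, b, hb, hab⟩ := mem_neighbors.1 hL
  have h1 := hT.dist_le (subCells_subset hLs) hz hb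
  have h2 := hT.dist_le hK ha hxK
  have h3 := dist_triangle4 z b a x
  rw [dist_comm b a] at h3
  rw [mem_closedBall]
  linarith

theorem mem_frontier_of_mem_cell {K : Finset (Eucl d)} (hK : K ∈ T.cells)
    {p : Eucl d} (hp : p ∈ K) (hpi : p ∉ interior (closure Ω)) : p ∈ frontier Ω := by
  refine ⟨convexHull_subset_closure hK (subset_convexHull ℝ _ hp), fun h => hpi ?_⟩
  exact interior_mono subset_closure h

/-- A cell that contains a point of `closure Ωk` has a vertex on `∂Ω`, or shares a vertex with a
cell of which a substantial part lies in `Ωk`. -/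
theorem IsRegularMesh.exists_cell_volume_ge {θ h : ℝ} (hT : T.IsRegularMesh θ h)
    (hΩ : IsBoundedLipschitzDomain Ω) (hδ : 0 ≤ δ) {C : ℝ} (hC : 0 ≤ C)
    {η : ℝ} (hη : 0 < η)
    (hball : ∀ y ∈ closure Ωk, ball y (θ / (d + 1) * h) ⊆ Ω →
      ∃ z, ball z (η * h) ⊆ Ωk ∩ ball y (θ / (d + 1) * h))
    {L : Finset (Eucl d)} (hL : L ∈ T.cells) {y : Eucl d} (hy : y ∈ closure Ωk)
    (hyL : y ∈ convexHull ℝ (L : Set (Eucl d))) (hint : ∀ p ∈ L, p ∈ interior (closure Ω)) :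
    ∃ p ∈ L, ∃ L' ∈ T.subCells Ωk δ, p ∈ L' ∧
      (η * h) ^ d * volume.real (ball (0 : Eucl d) 1) / ((C + 3) / θ) ^ d ≤
        volume.real (interior (convexHull ℝ (L' : Set (Eucl d))) ∩ Ωk) := by
  classical
  have hθ := hT.theta_pos
  have hh := hT.pos
  have hv := volume_real_unitBall_pos (d := d)
  have hcard : (L.card : ℝ) = d + 1 := by rw [T.card_of_mem_cells hL]; push_cast; rfl
  have hLne : L.Nonempty := Finset.card_pos.1 (by rw [T.card_of_mem_cells hL]; omega)
  obtain ⟨p, hp, hpy⟩ : ∃ p ∈ L, (1 : ℝ) / (d + 1) ≤ bary L p y := by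
    refine Finset.exists_le_of_sum_le hLne ?_
    rw [sum_bary hL, Finset.sum_const, nsmul_eq_mul, hcard, mul_one_div_cancel (by positivity)]
  -- The radius is the value 1/(d+1) from the pigeonhole choice of `p` divided by the Lipschitz
  -- constant 1/(θh).
  have hstar : ball y (θ / (d + 1) * h) ⊆ T.star p := by
    refine ball_subset_star (hint p hp) hL hyL (M := (θ * h)⁻¹) (by positivity)
      (fun L' hL' u v => hT.abs_bary_sub_le hL' p u v) (le_trans (le_of_eq ?_) hpy)
    field_simp
  have hcl : ball y (θ / (d + 1) * h) ⊆ Ω := by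
    refine Set.Subset.trans (interior_maximal (fun w hw => ?_) isOpen_ball)
      hΩ.interior_closure_subset
    obtain ⟨L', hL', -, hwL'⟩ := mem_star_iff.1 (hstar hw)
    exact convexHull_subset_closure hL' hwL'
  obtain ⟨z, hz⟩ := hball y hy hcl
  set s := {K ∈ T.cells | p ∈ K} with hs
  have hsne : s.Nonempty := ⟨L, Finset.mem_filter.2 ⟨hL, hp⟩⟩
  have hscard : (s.card : ℝ) ≤ ((C + 3) / θ) ^ d := by
    refine hT.card_le (x := p) (Finset.filter_subset _ _) (by linarith) fun K hK w hw => ?_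
    obtain ⟨hK1, hK2⟩ := Finset.mem_filter.1 hK
    have := hT.dist_le hK1 hw (subset_convexHull ℝ _ hK2)
    rw [mem_closedBall]
    nlinarith
  have hN : 0 < ((C + 3) / θ) ^ d := by positivity
  have hvol : (η * h) ^ d * volume.real (ball (0 : Eucl d) 1) ≤
      ∑ K ∈ s, volume.real (interior (convexHull ℝ (K : Set (Eucl d))) ∩ Ωk) := by
    have hae : ∀ K : Finset (Eucl d),
        volume.real (interior (convexHull ℝ (K : Set (Eucl d))) ∩ Ωk) =
          volume.real (convexHull ℝ (K : Set (Eucl d)) ∩ Ωk) := fun K =>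
      measureReal_congr ((interior_ae_eq_cell K).inter (Filter.EventuallyEq.refl _ _))
    simp_rw [hae]
    rw [← volume_real_ball z (by positivity)]
    refine le_trans (measureReal_mono ?_ ?_) (measureReal_biUnion_finset_le s _)
    · intro w hw
      obtain ⟨K, hK, hpK, hwK⟩ := mem_star_iff.1 (hstar (hz hw).2)
      exact Set.mem_iUnion₂.2 ⟨K, Finset.mem_filter.2 ⟨hK, hpK⟩, hwK, (hz hw).1⟩
    · refine (Bornology.IsBounded.measure_lt_top ?_).ne
      exact (Bornology.isBounded_biUnion_finset _).2 fun K _ =>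
        (isBounded_cell K).subset Set.inter_subset_left
  -- The cells of the star cover the ball in Ωk, and their number is bounded, so one of them
  -- contains at least an average share.
  obtain ⟨L', hL', hle⟩ : ∃ L' ∈ s,
      (η * h) ^ d * volume.real (ball (0 : Eucl d) 1) / ((C + 3) / θ) ^ d ≤
        volume.real (interior (convexHull ℝ (L' : Set (Eucl d))) ∩ Ωk) := by
    refine Finset.exists_le_of_sum_le hsne (le_trans ?_ hvol)
    rw [Finset.sum_const, nsmul_eq_mul, mul_div_assoc', div_le_iff₀ hN, mul_comm]
    exact mul_le_mul_of_nonneg_left hscard (by positivity)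
  obtain ⟨hL'c, hpL'⟩ := Finset.mem_filter.1 hL'
  refine ⟨p, hp, L', mem_subCells.2 ⟨hL'c, ?_⟩, hpL', hle⟩
  have hpos : 0 < volume.real (interior (convexHull ℝ (L' : Set (Eucl d))) ∩ Ωk) :=
    lt_of_lt_of_le (by positivity) hle
  obtain ⟨w, hw⟩ : (interior (convexHull ℝ (L' : Set (Eucl d))) ∩ Ωk).Nonempty := by
    by_contra h
    rw [Set.not_nonempty_iff_eq_empty.1 h, measureReal_empty] at hpos
    exact lt_irrefl _ hpos
  exact ⟨w, interior_subset hw.1, by rwa [infDist_zero_of_mem hw.2]⟩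

/-- The constant of the estimate on a single cell. -/
def cellConst (d : ℕ) (θ C η : ℝ) : ℝ :=
  2 + 2 * (2 * ((C + 3) / θ) ^ d + 4) ^ 2 *
    (8 / θ * (2 / θ) ^ d + 2 * ((C + 3) / θ) ^ d / η ^ d)

variable (T Ωk δ) in
/-- The part of the right-hand side of the estimate that belongs to one cell. -/
def cellData (G : Eucl d → Eucl d) (L : Finset (Eucl d)) : ℝ :=
  (∫ x in interior (convexHull ℝ (L : Set (Eucl d))), T.energy Ωk δ G x) +
    ∫ x in interior (convexHull ℝ (L : Set (Eucl d))) ∩ Ωk, ‖G x‖ ^ 2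

theorem integral_inter_norm_sq_nonneg (G : Eucl d → Eucl d) (S : Set (Eucl d)) :
    0 ≤ ∫ x in S, ‖G x‖ ^ 2 :=
  integral_nonneg fun _ => by positivity

theorem cellData_nonneg (G : Eucl d → Eucl d) {L : Finset (Eucl d)}
    (hL : L ∈ T.subCells Ωk δ) : 0 ≤ T.cellData Ωk δ G L :=
  add_nonneg (cell_integral_energy_nonneg G hL) (integral_inter_norm_sq_nonneg G _)

theorem cell_estimate (hd : 0 < d) (hΩ : IsBoundedLipschitzDomain Ω) {θ h : ℝ}
    (hT : T.IsRegularMesh θ h) (hΩk : IsOpen Ωk) (hne : Ωk.Nonempty)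
    (hδ : 0 ≤ δ) {C : ℝ} (hC : 0 ≤ C) (hδC : δ ≤ C * h) {η : ℝ} (hη : 0 < η)
    (hball : ∀ y ∈ closure Ωk, ball y (θ / (d + 1) * h) ⊆ Ω →
      ∃ z, ball z (η * h) ⊆ Ωk ∩ ball y (θ / (d + 1) * h))
    {G : Eucl d → Eucl d} (hG : MemLp G 2 (volume.restrict (T.extDomain Ωk δ)))
    {K : Finset (Eucl d)} (hK : K ∈ T.subCells Ωk δ) :
    ∫ x in interior (convexHull ℝ (K : Set (Eucl d))), ‖G x‖ ^ 2 ≤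
      cellConst d θ C η * ∑ L ∈ T.neighbors Ωk δ ((C + 1) * h) K, T.cellData Ωk δ G L := by
  classical
  have hθ := hT.theta_pos
  have hh := hT.pos
  have hv := volume_real_unitBall_pos (d := d)
  set v := volume.real (ball (0 : Eucl d) 1) with hvdef
  set g := T.nodeVal Ωk δ G with hg
  set E := ∑ L ∈ T.neighbors Ωk δ ((C + 1) * h) K, T.cellData Ωk δ G L with hE
  set N := ((C + 3) / θ) ^ d with hN
  have hN0 : 0 < N := by positivity
  have hdata : ∀ L ∈ T.neighbors Ωk δ ((C + 1) * h) K, T.cellData Ωk δ G L ≤ E := fun L hL =>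
    Finset.single_le_sum (f := fun L => T.cellData Ωk δ G L)
      (fun L' hL' => cellData_nonneg G (mem_neighbors.1 hL').1) hL
  have hE0 : 0 ≤ E := Finset.sum_nonneg fun L hL => cellData_nonneg G (mem_neighbors.1 hL).1
  have hen : ∀ L ∈ T.neighbors Ωk δ ((C + 1) * h) K,
      ∫ x in interior (convexHull ℝ (L : Set (Eucl d))), T.energy Ωk δ G x ≤ E := fun L hL =>
    (le_add_of_nonneg_right (integral_inter_norm_sq_nonneg G _)).trans (hdata L hL)
  set a := 8 / θ * (2 / θ) ^ d with ha
  set b := 2 * N / η ^ d with hb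
  have ha0 : 0 < a := by positivity
  have hb0 : 0 < b := by positivity
  -- A common bound for the jump of nodal values within a cell (the term with `a`) and for some
  -- nodal value of a cell with a substantial part in Ωk (the term with `b`).
  set D := √((a + b) * E / (h ^ d * v)) with hD
  have hD0 : 0 ≤ D := Real.sqrt_nonneg _
  have hDsq : D ^ 2 = (a + b) * E / (h ^ d * v) := Real.sq_sqrt (by positivity)
  have hedge : ∀ L ∈ T.neighbors Ωk δ ((C + 1) * h) K, ∀ p ∈ L, ∀ q ∈ L, ‖g p - g q‖ ≤ D := by
    intro L hL p hp q hq
    refine Real.le_sqrt_of_sq_le ?_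
    have h1 := norm_nodeVal_sub_sq_le hd hT hG (mem_neighbors.1 hL).1 hp hq
    have h2 : (θ * h / 2) ^ d * v * ‖g p - g q‖ ^ 2 ≤ 8 / θ * E :=
      h1.trans (mul_le_mul_of_nonneg_left (hen L hL) (by positivity))
    rw [le_div_iff₀ (by positivity)]
    have h3 : (2 / θ) ^ d * (θ * h / 2) ^ d = h ^ d := by
      rw [← mul_pow]; congr 1; field_simp
    have h4 := mul_le_mul_of_nonneg_left h2 (show 0 ≤ (2 / θ) ^ d by positivity)
    calc ‖g p - g q‖ ^ 2 * (h ^ d * v)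
        = (2 / θ) ^ d * ((θ * h / 2) ^ d * v * ‖g p - g q‖ ^ 2) := by rw [← h3]; ring
      _ ≤ (2 / θ) ^ d * (8 / θ * E) := h4
      _ = a * E := by rw [ha]; ring
      _ ≤ (a + b) * E := by nlinarith
  have hsource : ∀ L ∈ T.neighbors Ωk δ ((C + 1) * h) K,
      (η * h) ^ d * v / N ≤ volume.real (interior (convexHull ℝ (L : Set (Eucl d))) ∩ Ωk) →
      ∃ q ∈ L, ‖g q‖ ≤ D := by
    intro L hL hvol
    obtain ⟨q, hq, h1⟩ := exists_norm_nodeVal_sq_le hG hΩk (mem_neighbors.1 hL).1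
    refine ⟨q, hq, Real.le_sqrt_of_sq_le ?_⟩
    have h2 : (η * h) ^ d * v / N * ‖g q‖ ^ 2 ≤ 2 * E := by
      refine (mul_le_mul_of_nonneg_right hvol (by positivity)).trans (h1.trans ?_)
      rw [← mul_add]
      exact mul_le_mul_of_nonneg_left (hdata L hL) zero_le_two
    rw [le_div_iff₀ (by positivity)]
    have h4 := mul_le_mul_of_nonneg_left h2 (show 0 ≤ N / η ^ d by positivity)
    calc ‖g q‖ ^ 2 * (h ^ d * v) = N / η ^ d * ((η * h) ^ d * v / N * ‖g q‖ ^ 2) := by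
          rw [mul_pow]; field_simp
      _ ≤ N / η ^ d * (2 * E) := h4
      _ = b * E := by rw [hb]; ring
      _ ≤ (a + b) * E := by nlinarith
  obtain ⟨hKc, x, hxK, hxδ⟩ := mem_subCells.1 hK
  obtain ⟨y, hy, hxy⟩ := exists_mem_closure_infDist_eq_dist hne x
  rw [hxy] at hxδ
  obtain ⟨z, hz, hzsub, hzend⟩ := exists_segment_subset_or_notMem_interior
    (isClosed_closure (s := Ω)) (convexHull_subset_closure hKc hxK) y
  have hseg : ∀ w ∈ segment ℝ x z, infDist w Ωk ≤ δ ∧ dist x w ≤ C * h := by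
    intro w hw
    have hw' : w ∈ segment ℝ x y := (convex_segment x y).segment_subset
      (left_mem_segment ℝ x y) hz hw
    have h1 := dist_add_dist_of_mem_segment hw'
    have h2 := infDist_le_dist_of_mem (x := w) hy
    rw [infDist_closure] at h2
    have h3 := dist_nonneg (x := x) (y := w)
    have h4 := dist_nonneg (x := w) (y := y)
    constructor <;> linarith
  have hzs : z ∈ segment ℝ x z := right_mem_segment ℝ x z
  -- The chain: every point of the segment is within δ of Ωk, so all cells that it meets belong to
  -- the sub-triangulation.
  set s := (T.subCells Ωk δ).filter fun L : Finset (Eucl d) =>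
    (segment ℝ x z ∩ convexHull ℝ (L : Set (Eucl d))).Nonempty with hs
  have hsn : s ⊆ T.neighbors Ωk δ ((C + 1) * h) K := by
    intro L hL
    obtain ⟨hLs, w, hw, hwL⟩ := Finset.mem_filter.1 hL
    refine mem_neighbors.2 ⟨hLs, x, hxK, w, hwL, (hseg w hw).2.trans ?_⟩
    linarith
  have hscard : (s.card : ℝ) ≤ N :=
    le_trans (by exact_mod_cast Finset.card_le_card hsn) (hT.card_neighbors_le hC hKc)
  have hcov : ∀ w ∈ segment ℝ x z, ∃ L ∈ s, w ∈ convexHull ℝ (L : Set (Eucl d)) := by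
    intro w hw
    obtain ⟨L, hL, hwL⟩ := T.mem_closure_iff.1 (hzsub hw)
    exact ⟨L, Finset.mem_filter.2 ⟨mem_subCells.2 ⟨hL, w, hwL, (hseg w hw).1⟩, w, hw, hwL⟩, hwL⟩
  have hKs : K ∈ s := Finset.mem_filter.2 ⟨hK, x, left_mem_segment ℝ x z, hxK⟩
  have hvert : ∀ L : Finset (Eucl d), ∃ p, L ∈ s → p ∈ L := by
    intro L
    by_cases hL : L ∈ s
    · obtain ⟨p, hp⟩ : L.Nonempty := Finset.card_pos.1 (by
        rw [T.card_of_mem_cells (subCells_subset (Finset.mem_filter.1 hL).1)]; omega)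
      exact ⟨p, fun _ => hp⟩
    · exact ⟨0, fun h => absurd h hL⟩
  choose P hP using hvert
  obtain ⟨L, hLs, hzL⟩ := hcov z hzs
  have hLc := subCells_subset (Finset.mem_filter.1 hLs).1
  obtain ⟨p, hp, hgp⟩ : ∃ p ∈ L, ‖g p‖ ≤ 2 * D := by
    by_cases hint : ∀ p ∈ L, p ∈ interior (closure Ω)
    · have hzy : z = y := by
        refine hzend.resolve_right fun hzi => ?_
        obtain ⟨p, hp, hpi⟩ := exists_vertex_notMem_interior hLc hzL hzi
        exact hpi (hint p hp)
      obtain ⟨p, hp, L', hL', hpL', hvol⟩ := hT.exists_cell_volume_ge hΩ hδ hC hη hball hLc hy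
        (hzy ▸ hzL) hint
      -- The vertex `p` is within h of z, which is within C h of x; this is why neighbours are taken
      -- up to distance (C+1)h.
      have hL'n : L' ∈ T.neighbors Ωk δ ((C + 1) * h) K := by
        refine mem_neighbors.2 ⟨hL', x, hxK, p, subset_convexHull ℝ _ hpL', ?_⟩
        have h1 := hT.dist_le hLc hzL (subset_convexHull ℝ _ hp)
        have h2 := dist_triangle x z p
        have h3 := (hseg z hzs).2
        linarith
      obtain ⟨q, hq, hgq⟩ := hsource L' hL'n hvol
      refine ⟨p, hp, ?_⟩
      have h1 := hedge L' hL'n p hpL' q hq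
      have h2 := norm_add_le (g p - g q) (g q)
      rw [sub_add_cancel] at h2
      linarith
    · push Not at hint
      obtain ⟨p, hp, hpi⟩ := hint
      refine ⟨p, hp, ?_⟩
      rw [hg, nodeVal_of_mem_frontier G (mem_frontier_of_mem_cell hLc hp hpi), norm_zero]
      positivity
  -- Each cell is labelled by the nodal value at a chosen vertex. Two cells that meet share a vertex
  -- by conformity, so their labels differ by at most 2D.
  have hchain : dist (g (P K)) (g (P L)) ≤ s.card * (2 * D) := by
    refine dist_le_card_mul_of_isPreconnected (convex_segment x z).isPreconnected s
      (fun L => convexHull ℝ (L : Set (Eucl d))) (fun L _ => isClosed_cell L)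
      (fun w hw => ?_) (fun L hL => (Finset.mem_filter.1 hL).2) (fun L => g (P L)) (by positivity)
      (fun L₁ h₁ L₂ h₂ hmeet => ?_) hKs hLs
    · obtain ⟨L, hL, hwL⟩ := hcov w hw
      exact Set.mem_iUnion₂.2 ⟨L, hL, hwL⟩
    · obtain ⟨q, hq₁, hq₂⟩ := exists_mem_inter (subCells_subset (Finset.mem_filter.1 h₁).1)
        (subCells_subset (Finset.mem_filter.1 h₂).1) hmeet
      have e1 := hedge L₁ (hsn h₁) _ (hP L₁ h₁) q hq₁
      have e2 := hedge L₂ (hsn h₂) q hq₂ _ (hP L₂ h₂)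
      have e3 := dist_triangle (g (P L₁)) (g q) (g (P L₂))
      rw [dist_eq_norm, dist_eq_norm (g (P L₁)) (g q), dist_eq_norm (g q)] at e3
      rw [dist_eq_norm]
      linarith
  -- The factor 2N+4 collects D within K, 2ND along the chain, D within L and 2D for the nodal value
  -- at `p`.
  have hB : ∀ q ∈ K, ‖g q‖ ^ 2 ≤ (2 * N + 4) ^ 2 * D ^ 2 := by
    intro q hq
    have e1 := hedge K (hsn hKs) q hq _ (hP K hKs)
    have e2 := hedge L (hsn hLs) _ (hP L hLs) p hp
    have e3 : (s.card : ℝ) * (2 * D) ≤ N * (2 * D) :=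
      mul_le_mul_of_nonneg_right hscard (by positivity)
    rw [dist_eq_norm] at hchain
    have e4 : ‖g q‖ ≤ ‖g q - g (P K)‖ + ‖g (P K) - g (P L)‖ + ‖g (P L) - g p‖ + ‖g p‖ := by
      calc ‖g q‖ = ‖(g q - g (P K)) + (g (P K) - g (P L)) + (g (P L) - g p) + g p‖ := by
            congr 1; abel
        _ ≤ _ := norm_add₄_le
    rw [← mul_pow]
    refine pow_le_pow_left₀ (norm_nonneg _) ?_ 2
    linarith
  have hfin := cell_integral_norm_sq_le hT hG hK (by positivity) hB
  refine hfin.trans ?_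
  rw [hDsq, ← hvdef]
  have h1 : h ^ d * v * ((2 * N + 4) ^ 2 * ((a + b) * E / (h ^ d * v))) =
      (2 * N + 4) ^ 2 * (a + b) * E := by
    field_simp
  rw [h1]
  have h2 := hen K (hsn hKs)
  have h3 : cellConst d θ C η = 2 + 2 * (2 * N + 4) ^ 2 * (a + b) := rfl
  rw [h3]
  nlinarith

/-! ### The coercivity estimate -/

theorem cellConst_pos {θ C η : ℝ} (hθ : 0 < θ) (hC : 0 ≤ C) (hη : 0 < η) :
    0 < cellConst d θ C η := by
  rw [cellConst]; positivity

/-- The energies of the cells add up to the whole form, and the parts of the cells in Ωk are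
disjoint subsets of Ωk. -/
theorem sum_cellData_le {G : Eucl d → Eucl d}
    (hG : MemLp G 2 (volume.restrict (T.extDomain Ωk δ))) (hΩk : IsOpen Ωk)
    (hsub : Ωk ⊆ T.extDomain Ωk δ) :
    ∑ L ∈ T.subCells Ωk δ, T.cellData Ωk δ G L ≤
      (∫ x in Ωk, ‖G x‖ ^ 2) + T.stab Ωk δ G G := by
  have hint : IntegrableOn (fun x => ‖G x‖ ^ 2) Ωk := (integrableOn_norm_sq hG).mono_set hsub
  simp_rw [cellData]
  rw [Finset.sum_add_distrib, stab_eq_integral_energy hG,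
    setIntegral_extDomain (integrableOn_energy hG), add_comm]
  refine add_le_add ?_ le_rfl
  rw [← integral_biUnion_finset _
    (fun _ _ => isOpen_interior.measurableSet.inter hΩk.measurableSet)
    (fun K hK L hL hKL => (disjoint_interior (subCells_subset hK) (subCells_subset hL) hKL).mono
      Set.inter_subset_left Set.inter_subset_left)
    (fun K _ => hint.mono_set Set.inter_subset_right)]
  exact setIntegral_mono_set hint (Filter.Eventually.of_forall fun _ => by positivity)
    (LE.le.eventuallyLE (Set.iUnion₂_subset fun _ _ => Set.inter_subset_right))

theorem isCoercive (hd : 0 < d) (hΩ : IsBoundedLipschitzDomain Ω) {θ h : ℝ}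
    (hT : T.IsRegularMesh θ h) (hΩk : IsOpen Ωk) (hne : Ωk.Nonempty) (hsub : Ωk ⊆ Ω)
    (hδ : 0 ≤ δ) {C : ℝ} (hC : 0 ≤ C) (hδC : δ ≤ C * h) {η : ℝ} (hη : 0 < η)
    (hball : ∀ y ∈ closure Ωk, ball y (θ / (d + 1) * h) ⊆ Ω →
      ∃ z, ball z (η * h) ⊆ Ωk ∩ ball y (θ / (d + 1) * h)) :
    T.IsCoercive Ωk δ (((C + 3) / θ) ^ d * cellConst d θ C η) := by
  classical
  intro u G hu
  have hG := hu.memLp_grad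
  have hθ := hT.theta_pos
  have hc := cellConst_pos (d := d) hθ hC hη
  set X := T.cellData Ωk δ G with hX
  have hswap : ∑ K ∈ T.subCells Ωk δ, ∑ L ∈ T.neighbors Ωk δ ((C + 1) * h) K, X L ≤
      ∑ L ∈ T.subCells Ωk δ, ((C + 3) / θ) ^ d * X L := by
    -- Being neighbours is symmetric, so each cell is counted as often as it has neighbours.
    rw [Finset.sum_comm' (t' := T.subCells Ωk δ)
      (s' := fun L => T.neighbors Ωk δ ((C + 1) * h) L)]
    · refine Finset.sum_le_sum fun L hL => ?_
      rw [Finset.sum_const, nsmul_eq_mul]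
      exact mul_le_mul_of_nonneg_right (hT.card_neighbors_le hC (subCells_subset hL))
        (cellData_nonneg G hL)
    · intro K L
      constructor
      · rintro ⟨hK, hL⟩
        exact ⟨mem_neighbors_comm hK hL, (mem_neighbors.1 hL).1⟩
      · rintro ⟨hK, hL⟩
        exact ⟨(mem_neighbors.1 hK).1, mem_neighbors_comm hL hK⟩
  calc ∫ x in T.extDomain Ωk δ, ‖G x‖ ^ 2
      = ∑ K ∈ T.subCells Ωk δ, ∫ x in interior (convexHull ℝ (K : Set (Eucl d))), ‖G x‖ ^ 2 :=
        setIntegral_extDomain (integrableOn_norm_sq hG)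
    _ ≤ ∑ K ∈ T.subCells Ωk δ, cellConst d θ C η *
          ∑ L ∈ T.neighbors Ωk δ ((C + 1) * h) K, X L :=
        Finset.sum_le_sum fun K hK => cell_estimate hd hΩ hT hΩk hne hδ hC hδC hη hball hG hK
    _ ≤ cellConst d θ C η * ∑ L ∈ T.subCells Ωk δ, ((C + 3) / θ) ^ d * X L := by
        rw [← Finset.mul_sum]
        exact mul_le_mul_of_nonneg_left hswap hc.le
    _ = ((C + 3) / θ) ^ d * cellConst d θ C η * ∑ L ∈ T.subCells Ωk δ, X L := by
        rw [← Finset.mul_sum]; ring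
    _ ≤ _ := mul_le_mul_of_nonneg_left (sum_cellData_le hG hΩk (subset_extDomain hΩk hsub hδ))
        (by positivity)

end Triangulation

/-! ### The choice of constants on fine and on arbitrary meshes -/

/-- The estimate for the first subdomain: with a universal constant on fine meshes, and with a
constant that depends on the domain on all meshes. -/
theorem exists_isCoercive {Ω Ω₁ Ω₂ Γ : Set (Eucl d)} (hd : 0 < d)
    (hΩ : IsBoundedLipschitzDomain Ω) (hI : IsSmoothInterface Ω Ω₁ Ω₂ Γ) (σ τ C : ℝ) {θ : ℝ}
    (hθ : θ = (max σ 1 * max τ 1)⁻¹) :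
    (∃ h₀ : ℝ, 0 < h₀ ∧
      ∀ (T : Triangulation Ω) (h δ : ℝ), T.IsShapeRegular σ → T.IsQuasiUniform τ h →
        h ≤ h₀ → 0 ≤ δ → δ ≤ C * h →
        T.IsCoercive Ω₁ δ (((max C 0 + 3) / θ) ^ d *
          Triangulation.cellConst d θ (max C 0) (θ / (d + 1) / 4))) ∧
    (∃ η : ℝ, 0 < η ∧
      ∀ (T : Triangulation Ω) (h δ : ℝ), T.IsShapeRegular σ → T.IsQuasiUniform τ h →
        0 ≤ δ → δ ≤ C * h →
        T.IsCoercive Ω₁ δ (((max C 0 + 3) / θ) ^ d *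
          Triangulation.cellConst d θ (max C 0) η)) := by
  have hs : 0 < max σ 1 := lt_max_of_lt_right one_pos
  have ht : 0 < max τ 1 := lt_max_of_lt_right one_pos
  have hθ0 : 0 < θ := by rw [hθ]; positivity
  have hκ : 0 < θ / (d + 1) := by positivity
  set κ := θ / (d + 1) with hκdef
  have hsub : Ω₁ ⊆ Ω := by
    rw [← hI.union_eq]; exact fun x hx => Or.inl (Or.inl hx)
  have hne : Ω.Nonempty := hI.nonempty₁.mono hsub
  obtain ⟨r₀, hr₀, hr⟩ := hI.exists_ball_subset hΩ.isBounded
  -- The ball lemma is applied at radius min(κh, r₀), which is admissible for every h; any η with ηh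
  -- at most a quarter of it will do.
  have key : ∀ (T : Triangulation Ω) (h δ η : ℝ), T.IsShapeRegular σ → T.IsQuasiUniform τ h →
      0 ≤ δ → δ ≤ C * h → 0 < η → η * h ≤ min (κ * h) r₀ / 4 →
      T.IsCoercive Ω₁ δ (((max C 0 + 3) / θ) ^ d *
        Triangulation.cellConst d θ (max C 0) η) := by
    intro T h δ η hσ hτ hδ hδC hη hηh
    have hT := Triangulation.isRegularMesh hd hne hσ hτ
    rw [← hθ] at hT
    have hh := hT.pos
    refine Triangulation.isCoercive hd hΩ hT hI.isOpen₁ hI.nonempty₁ hsub hδ (le_max_right _ _)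
      (hδC.trans (mul_le_mul_of_nonneg_right (le_max_left _ _) hh.le)) hη fun y hy hyΩ => ?_
    have hle : ball y (min (κ * h) r₀) ⊆ ball y (κ * h) := ball_subset_ball (min_le_left _ _)
    obtain ⟨z, hz⟩ := hr (min (κ * h) r₀) (by positivity) (min_le_right _ _) y hy (hle.trans hyΩ)
    exact ⟨z, fun w hw => ⟨(hz (ball_subset_ball hηh hw)).1,
      hle (hz (ball_subset_ball hηh hw)).2⟩⟩
  constructor
  -- For h ≤ r₀/κ the minimum is κh, so η = κ/4 does not depend on the domain.
  · refine ⟨r₀ / κ, by positivity, fun T h δ hσ hτ hh hδ hδC =>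
      key T h δ _ hσ hτ hδ hδC (by positivity) ?_⟩
    rw [le_div_iff₀ hκ] at hh
    rw [min_eq_left (by linarith)]
    linarith
  -- An upper bound for every admissible h, by quasiuniformity and the boundedness of Ω; the added 1
  -- keeps it positive. Since h ≤ H, the radius r₀ is at least (r₀/H)h.
  · set H := max τ 1 * (diam Ω + 1) with hH
    have hH0 : 0 < H := mul_pos ht (by linarith [diam_nonneg (s := Ω)])
    refine ⟨min κ (r₀ / H) / 4, by positivity, fun T h δ hσ hτ hδ hδC =>
      key T h δ _ hσ hτ hδ hδC (by positivity) ?_⟩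
    have hh := (Triangulation.isRegularMesh hd hne hσ hτ).pos
    have hhH : h ≤ H := by
      obtain ⟨K, hK⟩ := Triangulation.exists_mem_cells (T := T) hne
      have h1 : diam (convexHull ℝ (K : Set (Eucl d))) ≤ diam Ω := by
        rw [← diam_closure Ω]
        exact diam_mono (Triangulation.convexHull_subset_closure hK) hΩ.isBounded.closure
      calc h ≤ τ * diam (convexHull ℝ (K : Set (Eucl d))) := (hτ K hK).2
        _ ≤ max τ 1 * diam (convexHull ℝ (K : Set (Eucl d))) :=
          mul_le_mul_of_nonneg_right (le_max_left _ _) diam_nonneg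
        _ ≤ H := mul_le_mul_of_nonneg_left (by linarith) ht.le
    rw [div_mul_eq_mul_div]
    refine div_le_div_of_nonneg_right (le_min ?_ ?_) (by norm_num)
    · exact mul_le_mul_of_nonneg_right (min_le_left _ _) hh.le
    · calc min κ (r₀ / H) * h ≤ r₀ / H * H :=
          mul_le_mul (min_le_right _ _) hhH hh.le (by positivity)
        _ = r₀ := div_mul_cancel₀ _ hH0.ne'

/-- Enlarging the constant needs a nonnegative bracket on the right, which the estimate itself
supplies since `c` is positive. -/
theorem Triangulation.IsCoercive.mono {Ω : Set (Eucl d)} {T : Triangulation Ω}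
    {Ωk : Set (Eucl d)} {δ c c' : ℝ} (hc : 0 < c) (hcc' : c ≤ c') (h : T.IsCoercive Ωk δ c) :
    T.IsCoercive Ωk δ c' := by
  intro u G hu
  have h1 := h u G hu
  have h2 : 0 ≤ ∫ x in T.extDomain Ωk δ, ‖G x‖ ^ 2 := integral_nonneg fun _ => by positivity
  exact h1.trans (mul_le_mul_of_nonneg_right hcc' (nonneg_of_mul_nonneg_right (h2.trans h1) hc))

end PG

end

theorem mainTheorem6 (d : ℕ) (hd : d = 2 ∨ d = 3) (σ τ C : ℝ) :
    ∃ c : ℝ, 0 < c ∧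
      ∀ Ω Ω₁ Ω₂ Γ : Set (PG.Eucl d),
        PG.IsBoundedLipschitzDomain Ω → PG.IsSmoothInterface Ω Ω₁ Ω₂ Γ →
        (∃ h₀ : ℝ, 0 < h₀ ∧
          ∀ (T : PG.Triangulation Ω) (h δ : ℝ), T.IsShapeRegular σ → T.IsQuasiUniform τ h →
            h ≤ h₀ → 0 ≤ δ → δ ≤ C * h →
            T.IsCoercive Ω₁ δ c ∧ T.IsCoercive Ω₂ δ c) ∧
        (∃ c' : ℝ, 0 < c' ∧
          ∀ (T : PG.Triangulation Ω) (h δ : ℝ), T.IsShapeRegular σ → T.IsQuasiUniform τ h →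
            0 ≤ δ → δ ≤ C * h →
            T.IsCoercive Ω₁ δ c' ∧ T.IsCoercive Ω₂ δ c') := by
  have hd0 : 0 < d := by omega
  have hs : 0 < max σ 1 := lt_max_of_lt_right one_pos
  have ht : 0 < max τ 1 := lt_max_of_lt_right one_pos
  obtain ⟨θ, hθ⟩ : ∃ θ, θ = (max σ 1 * max τ 1)⁻¹ := ⟨_, rfl⟩
  have hθ0 : 0 < θ := by rw [hθ]; positivity
  have hC : 0 ≤ max C 0 := le_max_right _ _
  have hpos : ∀ η : ℝ, 0 < η →
      0 < ((max C 0 + 3) / θ) ^ d * PG.Triangulation.cellConst d θ (max C 0) η := fun η hη =>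
    mul_pos (by positivity) (PG.Triangulation.cellConst_pos hθ0 hC hη)
  -- This η is fixed before the domain is chosen, so the constant depends only on d, σ, τ and C.
  refine ⟨_, hpos (θ / (d + 1) / 4) (by positivity), fun Ω Ω₁ Ω₂ Γ hΩ hI => ?_⟩
  obtain ⟨⟨h₁, hh₁, H₁⟩, η₁, hη₁, F₁⟩ := PG.exists_isCoercive hd0 hΩ hI σ τ C hθ
  obtain ⟨⟨h₂, hh₂, H₂⟩, η₂, hη₂, F₂⟩ := PG.exists_isCoercive hd0 hΩ hI.symm σ τ C hθ
  refine ⟨⟨min h₁ h₂, lt_min hh₁ hh₂, fun T h δ hσ hτ hh hδ hδC =>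
    ⟨H₁ T h δ hσ hτ (hh.trans (min_le_left _ _)) hδ hδC,
      H₂ T h δ hσ hτ (hh.trans (min_le_right _ _)) hδ hδC⟩⟩, ?_⟩
  exact ⟨_, lt_max_of_lt_left (hpos η₁ hη₁), fun T h δ hσ hτ hδ hδC =>
    ⟨(F₁ T h δ hσ hτ hδ hδC).mono (hpos η₁ hη₁) (le_max_left _ _),
      (F₂ T h δ hσ hτ hδ hδC).mono (hpos η₂ hη₂) (le_max_right _ _)⟩⟩
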